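/- Let $k$ be a field. A differential graded (DG) $k$-vector space is $V=\bigoplus_{n\in\mathbb Z}V_n$ with a differential $d:V_n\to V_{n+1}$, $d^2=0$; tensor products over $k$ carry $d(x\otimes y)=dx\otimes y+(-1)^{|x|}x\otimes dy$. Let $(C,\Delta,\epsilon)$ be a DG coalgebra over $k$, that is, a (coassociative, counital) coalgebra in the monoidal category of DG vector spaces, and let $\mathrm{Chain}(C)$ be the category of DG left $C$-comodules $(M,\rho_M)$, with morphisms the $C$-colinear maps of degree $0$ commuting with the differentials. Let $H(C)$ be the category with the same objects and with morphisms the homotopy classes of morphisms, where $f\sim g$ if $f-g=hd+dh$ for some graded $C$-colinear map $h$ of degree $-1$ (colinearity with the Koszul sign: $\rho(h(m))=\sum(-1)^{|c|}c\otimes h(m')$ if $\rho(m)=\sum c\otimes m'$). Let $D(C)$ be the localization of $H(C)$ at the quasi-isomorphisms. An object $X$ is *closed* if, for every $N\in\mathrm{Chain}(C)$, the localization functor induces a bijection $\mathrm{Hom}_{H(C)}(N,X)\to\mathrm{Hom}_{D(C)}(N,X)$. Let $\mathrm{Chain}^+(C)$, $H^+(C)$, $D^+(C)$ be the full subcategories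 of the objects isomorphic (in the respective category) to a left bounded comodule, i.e. one with $M_n=0$ for all sufficiently small $n$. For $M\in\mathrm{Chain}(C)$ the standard (cobar) resolution is $C(M)=\bigoplus_{r\ge1}C^{\otimes r}\otimes M$, where $(c_1,\dots,c_r,m)$ has degree $|c_1|+\dots+|c_r|+|m|+r-1$, with the differential $$\partial(c_1,\dots,c_r,m)=(-1)^{r-1}d(c_1,\dots,c_r,m)+\sum_{i=1}^{r+1}(-1)^{i+1}(c_1,\dots,\Delta(c_i),\dots,c_r,m)$$ (where $d$ is the differential of the tensor product $C^{\otimes r}\otimes M$, $c_{r+1}=m$ and $\Delta(m)=\rho_M(m)$) and the coaction $(c_1,\dots,c_r,m)\mapsto\sum(-1)^{(r-1)|c_1'|}\,c_1'\otimes(c_1'',c_2,\dots,c_r,m)$, where $\Delta(c_1)=\sum c_1'\otimes c_1''$. This is a functor $\mathrm{Chain}(C)\to\mathrm{Chain}(C)$, and $\rho_M:M\to C\otimes M\subseteq C(M)$ is a morphism natural in $M$. **Theorem.** Let $C$ be positively graded, i.e. $C_n=0$ for $n<0$. For every left bounded $M\in\mathrm{Chain}(C)$, the object $C(M)$ is closed,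 $C(M)$ is left bounded, and the natural morphism $\rho_M:M\to C(M)$ is a quasi-isomorphism. Consequently the localization functor induces an equivalence from the full subcategory of closed objects of $H^+(C)$ to $D^+(C)$. -/

import Mathlib

universe u v

noncomputable section

open CategoryTheory TensorProduct DirectSum

namespace DGCo

/-- A differential `ℤ`-graded `k`-vector space `V = ⨁ n, V_n` with `d : V_n → V_{n+1}`, `d² = 0`. -/
structure DGModule (k : Type u) [Field k] where
  carrier : Type v
  [addCommGroup : AddCommGroup carrier]
  [module : Module k carrier]
  /-- the homogeneous components -/
  deg : ℤ → Submodule k carrier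
  isInternal : DirectSum.IsInternal deg
  /-- the differential -/
  d : carrier →ₗ[k] carrier
  d_mem : ∀ {n : ℤ} {x : carrier}, x ∈ deg n → d x ∈ deg (n + 1)
  d_comp_d : d ∘ₗ d = 0

attribute [instance] DGModule.addCommGroup DGModule.module

instance (k : Type u) [Field k] : CoeSort (DGModule.{u, v} k) (Type v) := ⟨DGModule.carrier⟩

variable {k : Type u} [Field k]

/-- A criterion for a family of submodules to be a grading. -/
theorem isInternal_of_split {V : Type v} [AddCommGroup V] [Module k V] (A : ℤ → Submodule k V)
    (hA : iSup A = ⊤) (Φ : V →ₗ[k] (ℤ →₀ V))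
    (hΦ : ∀ (n : ℤ) (x : V), x ∈ A n → Φ x = Finsupp.single n x) : DirectSum.IsInternal A := by
  classical
  constructor
  · have key : ∀ (y : ⨁ i, A i) (i : ℤ),
        Φ (DirectSum.coeAddMonoidHom A y) i = (y i : V) := by
      intro y i
      induction y using DirectSum.induction_on with
      | zero => simp
      | of j x =>
        rw [DirectSum.coeAddMonoidHom_of, hΦ j _ x.2, DirectSum.coe_of_apply, Finsupp.single_apply]
        split_ifs <;> simp
      | add x y hx hy => simp [hx, hy]
    intro x y hxy
    refine DFinsupp.ext fun i => Subtype.ext ?_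
    have h := key x i
    rw [hxy, key y i] at h
    exact h.symm
  · intro x
    have h : x ∈ iSup A := hA ▸ Submodule.mem_top
    obtain ⟨f, hf⟩ := (Submodule.mem_iSup_iff_exists_dfinsupp' A x).1 h
    refine ⟨f, ?_⟩
    rw [← hf]
    exact DFinsupp.sumAddHom_apply _ _

namespace DGModule

/-- `v ↦ ∑ n, v_n · e_n`, the family of homogeneous components of a vector. -/
def comps (V : DGModule.{u, v} k) : V →ₗ[k] (ℤ →₀ V) :=
  DirectSum.toModule k ℤ (ℤ →₀ V) (fun n => Finsupp.lsingle n ∘ₗ (V.deg n).subtype) ∘ₗ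
    (LinearEquiv.ofBijective (DirectSum.coeLinearMap V.deg) V.isInternal).symm.toLinearMap

theorem comps_of_mem (V : DGModule.{u, v} k) {n : ℤ} {x : V} (hx : x ∈ V.deg n) :
    V.comps x = Finsupp.single n x := by
  have h : (LinearEquiv.ofBijective (DirectSum.coeLinearMap V.deg) V.isInternal).symm x =
      DirectSum.lof k ℤ (fun n => V.deg n) n ⟨x, hx⟩ := by
    rw [LinearEquiv.symm_apply_eq]
    exact (DirectSum.coeLinearMap_lof V.deg n ⟨x, hx⟩).symm
  rw [comps, LinearMap.comp_apply, LinearEquiv.coe_coe, h, DirectSum.toModule_lof]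
  rfl

/-- The parity involution: `σ v = (-1)^n v` for `v` homogeneous of degree `n`. -/
def parity (V : DGModule.{u, v} k) : Module.End k V :=
  Finsupp.lsum k (fun n : ℤ => ((n.negOnePow : ℤ) : k) • LinearMap.id) ∘ₗ V.comps

theorem parity_of_mem (V : DGModule.{u, v} k) {n : ℤ} {x : V} (hx : x ∈ V.deg n) :
    V.parity x = ((n.negOnePow : ℤ) : k) • x := by
  simp [parity, V.comps_of_mem hx]

/-- Linear maps that agree on homogeneous elements are equal. -/
theorem hom_ext (V : DGModule.{u, v} k) {X : Type v} [AddCommGroup X] [Module k X]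
    {f g : V →ₗ[k] X} (h : ∀ n, ∀ x ∈ V.deg n, f x = g x) : f = g := by
  have h1 : (⊤ : Submodule k V) ≤ LinearMap.eqLocus f g := by
    rw [← V.isInternal.submodule_iSup_eq_top]
    exact iSup_le h
  exact LinearMap.ext fun x => h1 Submodule.mem_top

theorem parity_mem (V : DGModule.{u, v} k) {n : ℤ} {x : V} (hx : x ∈ V.deg n) :
    V.parity x ∈ V.deg n := by
  rw [V.parity_of_mem hx]; exact Submodule.smul_mem _ _ hx

theorem sign_mul_self (n : ℤ) : ((n.negOnePow : ℤ) : k) * ((n.negOnePow : ℤ) : k) = 1 := by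
  rw [← Int.cast_mul, ← Units.val_mul, Int.units_mul_self]; simp

theorem parity_comp_parity (V : DGModule.{u, v} k) : V.parity ∘ₗ V.parity = LinearMap.id := by
  refine V.hom_ext fun n x hx => ?_
  rw [LinearMap.comp_apply, V.parity_of_mem hx, map_smul, V.parity_of_mem hx, smul_smul,
    sign_mul_self, one_smul, LinearMap.id_apply]

theorem parity_comp_d (V : DGModule.{u, v} k) : V.parity ∘ₗ V.d = -(V.d ∘ₗ V.parity) := by
  refine V.hom_ext fun n x hx => ?_
  simp [V.parity_of_mem hx, V.parity_of_mem (V.d_mem hx), Int.negOnePow_succ]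

/-- `(V ⊗ W)_n = ⨁_{p + q = n} V_p ⊗ W_q`. -/
def tensorDeg (V W : DGModule.{u, v} k) (n : ℤ) : Submodule k (V ⊗[k] W) :=
  ⨆ p : ℤ, Submodule.map₂ (TensorProduct.mk k V W) (V.deg p) (W.deg (n - p))

/-- `d (x ⊗ y) = d x ⊗ y + (-1)^|x| x ⊗ d y`. -/
def tensorD (V W : DGModule.{u, v} k) : V ⊗[k] W →ₗ[k] V ⊗[k] W :=
  TensorProduct.map V.d LinearMap.id + TensorProduct.map V.parity W.d

theorem tmul_mem (V W : DGModule.{u, v} k) {p q n : ℤ} (h : p + q = n) {x : V} {y : W}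
    (hx : x ∈ V.deg p) (hy : y ∈ W.deg q) : x ⊗ₜ[k] y ∈ tensorDeg V W n := by
  obtain rfl : q = n - p := by omega
  exact Submodule.mem_iSup_of_mem p (Submodule.apply_mem_map₂ _ hx hy)

/-- To map `(V ⊗ W)_n` into a subspace it is enough to map homogeneous pure tensors there. -/
theorem tensorDeg_le (V W : DGModule.{u, v} k) {n : ℤ} {S : Submodule k (V ⊗[k] W)}
    (h : ∀ p q : ℤ, p + q = n → ∀ x ∈ V.deg p, ∀ y ∈ W.deg q, x ⊗ₜ[k] y ∈ S) :
    tensorDeg V W n ≤ S :=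
  iSup_le fun p => Submodule.map₂_le.2 fun x hx y hy => h p (n - p) (by omega) x hx y hy

theorem iSup_tensorDeg (V W : DGModule.{u, v} k) : iSup (tensorDeg V W) = ⊤ := by
  rw [eq_top_iff, ← TensorProduct.map₂_mk_top_top_eq_top,
    ← V.isInternal.submodule_iSup_eq_top, ← W.isInternal.submodule_iSup_eq_top,
    Submodule.map₂_iSup_left]
  refine iSup_le fun p => ?_
  rw [Submodule.map₂_iSup_right]
  refine iSup_le fun q => Submodule.map₂_le.2 fun x hx y hy => ?_
  exact Submodule.mem_iSup_of_mem (p + q) (tmul_mem V W rfl hx hy)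

theorem isInternal_tensorDeg (V W : DGModule.{u, v} k) :
    DirectSum.IsInternal (tensorDeg V W) := by
  classical
  let Φ : V ⊗[k] W →ₗ[k] (ℤ →₀ (V ⊗[k] W)) :=
    Finsupp.lmapDomain (V ⊗[k] W) k (fun pq : ℤ × ℤ => pq.1 + pq.2) ∘ₗ
      (finsuppTensorFinsupp k k V W ℤ ℤ).toLinearMap ∘ₗ TensorProduct.map V.comps W.comps
  refine isInternal_of_split _ (iSup_tensorDeg V W) Φ fun n x hx => ?_
  have : tensorDeg V W n ≤ LinearMap.eqLocus Φ (Finsupp.lsingle n) := by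
    refine tensorDeg_le V W fun p q h x hx y hy => ?_
    simp [Φ, V.comps_of_mem hx, W.comps_of_mem hy, Finsupp.mapDomain_single, h]
  exact this hx

/-- The tensor product of differential graded vector spaces. -/
abbrev tensor (V W : DGModule.{u, v} k) : DGModule.{u, v} k where
  carrier := V ⊗[k] W
  deg := tensorDeg V W
  isInternal := isInternal_tensorDeg V W
  d := tensorD V W
  d_mem := by
    intro n x hx
    have : tensorDeg V W n ≤ (tensorDeg V W (n + 1)).comap (tensorD V W) := by
      refine tensorDeg_le V W fun p q h x hx y hy => ?_
      simp only [Submodule.mem_comap, tensorD, LinearMap.add_apply, TensorProduct.map_tmul,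
        LinearMap.id_apply]
      exact Submodule.add_mem _ (tmul_mem V W (by omega) (V.d_mem hx) hy)
        (tmul_mem V W (by omega) (V.parity_mem hx) (W.d_mem hy))
    exact this hx
  d_comp_d := by
    have h1 := V.parity_comp_d
    ext x y
    have hd : V.d (V.d x) = 0 := LinearMap.congr_fun V.d_comp_d x
    have hd' : W.d (W.d y) = 0 := LinearMap.congr_fun W.d_comp_d y
    have hp : V.parity (V.d x) = -V.d (V.parity x) := LinearMap.congr_fun h1 x
    simp [tensorD, hd, hd', hp, TensorProduct.neg_tmul]

end DGModule

/-- A differential graded `k`-coalgebra: a coalgebra whose comultiplication and counit are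
morphisms of differential graded vector spaces (`k` sits in degree `0` with `d = 0`). -/
structure DGCoalgebra (k : Type u) [Field k] extends DGModule.{u, v} k where
  [coalgebra : Coalgebra k carrier]
  comul_mem : ∀ {n : ℤ} {x : carrier}, x ∈ deg n →
    Coalgebra.comul (R := k) x ∈ toDGModule.tensorDeg toDGModule n
  comul_comp_d : Coalgebra.comul (R := k) ∘ₗ d =
    toDGModule.tensorD toDGModule ∘ₗ Coalgebra.comul (R := k)
  counit_of_mem : ∀ {n : ℤ} {x : carrier}, x ∈ deg n → n ≠ 0 → Coalgebra.counit (R := k) x = 0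
  counit_comp_d : Coalgebra.counit (R := k) ∘ₗ d = 0

attribute [instance] DGCoalgebra.coalgebra

/-- `C` is positively graded: `C_n = 0` for `n < 0`. -/
def DGCoalgebra.PositivelyGraded (C : DGCoalgebra.{u, v} k) : Prop := ∀ n < 0, C.deg n = ⊥

/-- `Δ ⊗ id : C ⊗ W → C ⊗ (C ⊗ W)`. -/
def DGCoalgebra.comulTensor (C : DGCoalgebra.{u, v} k) (W : Type v) [AddCommGroup W] [Module k W] :
    C.carrier ⊗[k] W →ₗ[k] C.carrier ⊗[k] (C.carrier ⊗[k] W) :=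
  (TensorProduct.assoc k C.carrier C.carrier W).toLinearMap ∘ₗ
    TensorProduct.map Coalgebra.comul LinearMap.id

/-- A differential graded vector space `M` with a coassociative map `M → C ⊗ M` of differential
graded vector spaces (no counit condition). -/
structure DGPrecomodule (C : DGCoalgebra.{u, v} k) extends DGModule.{u, v} k where
  coact : carrier →ₗ[k] C.carrier ⊗[k] carrier
  coact_mem : ∀ {n : ℤ} {x : carrier}, x ∈ deg n → coact x ∈ C.toDGModule.tensorDeg toDGModule n
  coact_comp_d : coact ∘ₗ d = C.toDGModule.tensorD toDGModule ∘ₗ coact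
  coassoc : C.comulTensor carrier ∘ₗ coact = TensorProduct.map LinearMap.id coact ∘ₗ coact

/-- A differential graded left `C`-comodule; these are the objects of `Chain(C)`. -/
structure DGComodule (C : DGCoalgebra.{u, v} k) extends DGPrecomodule.{u, v} C where
  counit_coact : (TensorProduct.lid k carrier).toLinearMap ∘ₗ
    TensorProduct.map Coalgebra.counit LinearMap.id ∘ₗ coact = LinearMap.id

variable {C : DGCoalgebra.{u, v} k}

/-- A morphism: a `k`-linear `C`-colinear map of degree `0` that commutes with the differentials. -/
@[ext]
structure DGPrecomodule.Hom (M N : DGPrecomodule.{u, v} C) where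
  lin : M.carrier →ₗ[k] N.carrier
  map_mem : ∀ {n : ℤ} {x : M.carrier}, x ∈ M.deg n → lin x ∈ N.deg n
  comp_d : lin ∘ₗ M.d = N.d ∘ₗ lin
  colinear : N.coact ∘ₗ lin = TensorProduct.map LinearMap.id lin ∘ₗ M.coact

/-- The category `Chain(C)`. -/
instance : Category.{v} (DGComodule.{u, v} C) where
  Hom M N := DGPrecomodule.Hom M.toDGPrecomodule N.toDGPrecomodule
  id M :=
    { lin := LinearMap.id
      map_mem := fun h => h
      comp_d := rfl
      colinear := by simp }
  comp {M N P} f g :=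
    { lin := g.lin ∘ₗ f.lin
      map_mem := fun h => g.map_mem (f.map_mem h)
      comp_d := by rw [LinearMap.comp_assoc, f.comp_d, ← LinearMap.comp_assoc, g.comp_d,
        LinearMap.comp_assoc]
      colinear := by
        rw [← LinearMap.comp_assoc, g.colinear, LinearMap.comp_assoc, f.colinear,
          ← LinearMap.comp_assoc, ← TensorProduct.map_comp, LinearMap.id_comp] }

/-- `M` is left bounded: `M_n = 0` for all sufficiently small `n`. -/
def DGComodule.LeftBounded (M : DGComodule.{u, v} C) : Prop := ∃ n₀ : ℤ, ∀ n < n₀, M.deg n = ⊥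

/-- The homology `ker d / im d`. -/
abbrev DGModule.Homology (V : DGModule.{u, v} k) : Type v :=
  LinearMap.ker V.d ⧸ (LinearMap.range V.d).comap (LinearMap.ker V.d).subtype

/-- The restriction of a morphism to cycles. -/
def cyclesMap {M N : DGComodule.{u, v} C} (f : M ⟶ N) :
    LinearMap.ker M.d →ₗ[k] LinearMap.ker N.d :=
  f.lin.restrict fun x hx => by
    have h := LinearMap.congr_fun f.comp_d x
    simp only [LinearMap.comp_apply, LinearMap.mem_ker.1 hx, map_zero] at h
    exact LinearMap.mem_ker.2 h.symm

/-- The map induced in homology. -/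
def homologyMap {M N : DGComodule.{u, v} C} (f : M ⟶ N) : M.Homology →ₗ[k] N.Homology :=
  Submodule.mapQ _ _ (cyclesMap f) (by
    rintro ⟨x, hx⟩ ⟨y, hy⟩
    exact ⟨f.lin y, by rw [← LinearMap.comp_apply, ← f.comp_d, LinearMap.comp_apply, hy]; rfl⟩)

/-- `f` is a quasi-isomorphism. -/
def QuasiIso {M N : DGComodule.{u, v} C} (f : M ⟶ N) : Prop := Function.Bijective (homologyMap f)

/-- `f` and `g` are homotopic: `f - g = h d + d h` for a graded `C`-colinear map `h` of degree `-1`.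
As `h` has degree `-1`, its colinearity reads
`ρ (h m) = ∑ (-1)^|c| c ⊗ h m'` for `ρ m = ∑ c ⊗ m'`, by the Koszul sign rule. -/
def Homotopic (C : DGCoalgebra.{u, v} k) : HomRel (DGComodule.{u, v} C) := fun M N f g =>
  ∃ h : M.carrier →ₗ[k] N.carrier,
    (∀ (n : ℤ) (x : M.carrier), x ∈ M.deg n → h x ∈ N.deg (n - 1)) ∧
    N.coact ∘ₗ h = TensorProduct.map C.parity h ∘ₗ M.coact ∧
    f.lin - g.lin = h ∘ₗ M.d + N.d ∘ₗ h

/-- Homotopy is an equivalence relation compatible with composition, so that the morphisms of the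
quotient category below are exactly the homotopy classes of morphisms. -/
instance (C : DGCoalgebra.{u, v} k) : Congruence (Homotopic C) where
  comp_left {X Y Z} f {g g'} := by
    rintro ⟨h, hdeg, hco, hh⟩
    refine ⟨h ∘ₗ f.lin, fun n x hx => hdeg n _ (f.map_mem hx), ?_, ?_⟩
    · rw [← LinearMap.comp_assoc, hco, LinearMap.comp_assoc, f.colinear, ← LinearMap.comp_assoc,
        ← TensorProduct.map_comp, LinearMap.comp_id]
    · change g.lin ∘ₗ f.lin - g'.lin ∘ₗ f.lin = _
      rw [← LinearMap.sub_comp, hh, LinearMap.add_comp, LinearMap.comp_assoc, ← f.comp_d,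
        LinearMap.comp_assoc, LinearMap.comp_assoc]
  comp_right {X Y Z} {f f'} g := by
    rintro ⟨h, hdeg, hco, hh⟩
    refine ⟨g.lin ∘ₗ h, fun n x hx => g.map_mem (hdeg n x hx), ?_, ?_⟩
    · rw [← LinearMap.comp_assoc, g.colinear, LinearMap.comp_assoc, hco, ← LinearMap.comp_assoc,
        ← TensorProduct.map_comp, LinearMap.id_comp]
    · change g.lin ∘ₗ f.lin - g.lin ∘ₗ f'.lin = _
      rw [← LinearMap.comp_sub, hh, LinearMap.comp_add, ← LinearMap.comp_assoc,
        ← LinearMap.comp_assoc, ← LinearMap.comp_assoc, g.comp_d]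
  equivalence {X Y} :=
    { refl := fun f => ⟨0, fun _ _ _ => by simp, by simp, by simp⟩
      symm := by
        rintro f g ⟨h, hdeg, hco, hh⟩
        refine ⟨-h, fun n x hx => Submodule.neg_mem _ (hdeg n x hx), ?_, ?_⟩
        · rw [LinearMap.comp_neg, hco, ← neg_one_smul k h, TensorProduct.map_smul_right,
            LinearMap.smul_comp]
          exact (neg_one_smul k _).symm
        · rw [← neg_sub, hh, LinearMap.neg_comp, LinearMap.comp_neg, neg_add]
      trans := by
        rintro f g l ⟨h, hdeg, hco, hh⟩ ⟨h', hdeg', hco', hh'⟩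
        refine ⟨h + h', fun n x hx => Submodule.add_mem _ (hdeg n x hx) (hdeg' n x hx), ?_, ?_⟩
        · rw [LinearMap.comp_add, hco, hco', TensorProduct.map_add_right, LinearMap.add_comp]
        · rw [← sub_add_sub_cancel f.lin g.lin l.lin, hh, hh', LinearMap.add_comp,
            LinearMap.comp_add]
          abel }

/-- The homotopy category `H(C)`. -/
abbrev HCat (C : DGCoalgebra.{u, v} k) := CategoryTheory.Quotient (Homotopic C)

/-- The projection `Chain(C) ⥤ H(C)`. -/
abbrev toH (C : DGCoalgebra.{u, v} k) : DGComodule.{u, v} C ⥤ HCat C :=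
  CategoryTheory.Quotient.functor (Homotopic C)

/-- The class of quasi-isomorphisms in `H(C)`. -/
def quasiIsos (C : DGCoalgebra.{u, v} k) : MorphismProperty (HCat C) := fun X Y φ =>
  ∃ f : X.as ⟶ Y.as, (toH C).map f = φ ∧ QuasiIso f

/-- The derived category `D(C)`. -/
abbrev DCat (C : DGCoalgebra.{u, v} k) := (quasiIsos C).Localization

/-- The localization functor `H(C) ⥤ D(C)`. -/
abbrev toD (C : DGCoalgebra.{u, v} k) : HCat C ⥤ DCat C := (quasiIsos C).Q

/-- `X` is closed: for every `M` in `Chain(C)`, the localization functor induces a bijection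
`Hom_{H(C)}(M, X) → Hom_{D(C)}(M, X)`. -/
def IsClosedObj (X : DGComodule.{u, v} C) : Prop :=
  ∀ M : DGComodule.{u, v} C, Function.Bijective
    (fun φ : (toH C).obj M ⟶ (toH C).obj X => (toD C).map φ)

/-- The objects of `H⁺(C)`: those isomorphic in `H(C)` to a left bounded comodule. -/
def hPlus (C : DGCoalgebra.{u, v} k) : ObjectProperty (HCat C) := fun X =>
  ∃ N : DGComodule.{u, v} C, N.LeftBounded ∧ Nonempty (X ≅ (toH C).obj N)

/-- The objects of `D⁺(C)`: those isomorphic in `D(C)` to a left bounded comodule. -/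
def dPlus (C : DGCoalgebra.{u, v} k) : ObjectProperty (DCat C) := fun X =>
  ∃ N : DGComodule.{u, v} C, N.LeftBounded ∧ Nonempty (X ≅ (toD C).obj ((toH C).obj N))

/-- The closed objects of `H⁺(C)`. -/
def hPlusClosed (C : DGCoalgebra.{u, v} k) : ObjectProperty (HCat C) := fun X =>
  hPlus C X ∧ IsClosedObj X.as

/-- The functor from the full subcategory of closed objects of `H⁺(C)` to `D⁺(C)` that is induced
by the localization functor. -/
def closedToDPlus (C : DGCoalgebra.{u, v} k) :
    (hPlusClosed C).FullSubcategory ⥤ (dPlus C).FullSubcategory :=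
  (dPlus C).lift ((hPlusClosed C).ι ⋙ toD C) (by
    rintro ⟨X, ⟨N, hN, ⟨e⟩⟩, -⟩
    exact ⟨N, hN, ⟨(toD C).mapIso e⟩⟩)

namespace DGModule

theorem map_mem_tensorDeg {V W V' W' : DGModule.{u, v} k} {f : V →ₗ[k] V'} {g : W →ₗ[k] W'}
    {a b : ℤ} (hf : ∀ n, ∀ x ∈ V.deg n, f x ∈ V'.deg (n + a))
    (hg : ∀ n, ∀ x ∈ W.deg n, g x ∈ W'.deg (n + b)) {n m : ℤ} (hm : n + a + b = m)
    {x : V ⊗[k] W} (hx : x ∈ tensorDeg V W n) :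
    TensorProduct.map f g x ∈ tensorDeg V' W' m := by
  have : tensorDeg V W n ≤ (tensorDeg V' W' m).comap (TensorProduct.map f g) := by
    refine tensorDeg_le V W fun p q h x hx y hy => ?_
    rw [Submodule.mem_comap, TensorProduct.map_tmul]
    exact tmul_mem V' W' (by omega) (hf p x hx) (hg q y hy)
  exact this hx

theorem parity_tensor (V W : DGModule.{u, v} k) :
    (tensor V W).parity = TensorProduct.map V.parity W.parity := by
  refine (tensor V W).hom_ext fun n x hx => ?_
  rw [parity_of_mem _ hx]
  have : tensorDeg V W n ≤ LinearMap.eqLocus (((n.negOnePow : ℤ) : k) • LinearMap.id)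
      (TensorProduct.map V.parity W.parity) := by
    refine tensorDeg_le V W fun p q h x hx' y hy => ?_
    subst h
    simp only [LinearMap.mem_eqLocus, LinearMap.smul_apply, LinearMap.id_apply,
      TensorProduct.map_tmul, V.parity_of_mem hx', W.parity_of_mem hy, TensorProduct.smul_tmul_smul,
      Int.negOnePow_add, Units.val_mul, Int.cast_mul]
  exact this hx

/-- A map of degree `0` commutes with the parity involutions. -/
theorem comp_parity {V W : DGModule.{u, v} k} {f : V →ₗ[k] W}
    (hf : ∀ n, ∀ x ∈ V.deg n, f x ∈ W.deg n) : f ∘ₗ V.parity = W.parity ∘ₗ f := by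
  refine V.hom_ext fun n x hx => ?_
  simp [V.parity_of_mem hx, W.parity_of_mem (hf n x hx)]

section Total

variable (X : ℕ → DGModule.{u, v} k) (β : ∀ n, X n →ₗ[k] X (n + 1))

/-- `(⨁ n, X_n)_p = ⨁ n, (X_n)_{p - n}`. -/
def totalDeg (p : ℤ) : Submodule k (⨁ n, X n) :=
  ⨆ n : ℕ, ((X n).deg (p - n)).map (DirectSum.lof k ℕ (fun n => X n) n)

/-- On `X_n` the differential is `(-1)^n d + β`. -/
def totalD : (⨁ n, X n) →ₗ[k] ⨁ n, X n :=
  DirectSum.toModule k ℕ _ fun n =>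
    (-1 : k) ^ n • (DirectSum.lof k ℕ (fun n => X n) n ∘ₗ (X n).d) +
      DirectSum.lof k ℕ (fun n => X n) (n + 1) ∘ₗ β n

theorem lof_mem_totalDeg {n : ℕ} {p q : ℤ} (h : q + n = p) {x : X n} (hx : x ∈ (X n).deg q) :
    DirectSum.lof k ℕ (fun n => X n) n x ∈ totalDeg X p := by
  obtain rfl : q = p - n := by omega
  exact Submodule.mem_iSup_of_mem n (Submodule.mem_map_of_mem hx)

theorem totalDeg_le {p : ℤ} {S : Submodule k (⨁ n, X n)}
    (h : ∀ (n : ℕ) (q : ℤ), q + n = p → ∀ x ∈ (X n).deg q,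
      DirectSum.lof k ℕ (fun n => X n) n x ∈ S) : totalDeg X p ≤ S :=
  iSup_le fun n => Submodule.map_le_iff_le_comap.2 fun x hx => h n (p - n) (by omega) x hx

theorem iSup_totalDeg : iSup (totalDeg X) = ⊤ := by
  rw [eq_top_iff]
  rintro x -
  induction x using DirectSum.induction_on with
  | zero => exact Submodule.zero_mem _
  | of n x =>
    have h : (⊤ : Submodule k (X n)) ≤
        (iSup (totalDeg X)).comap (DirectSum.lof k ℕ (fun n => X n) n) := by
      rw [← (X n).isInternal.submodule_iSup_eq_top]
      exact iSup_le fun q x hx =>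
        Submodule.mem_iSup_of_mem (q + n) (lof_mem_totalDeg X rfl hx)
    exact h Submodule.mem_top
  | add x y hx hy => exact Submodule.add_mem _ hx hy

theorem isInternal_totalDeg : DirectSum.IsInternal (totalDeg X) := by
  let Φ : (⨁ n, X n) →ₗ[k] (ℤ →₀ ⨁ n, X n) :=
    DirectSum.toModule k ℕ _ fun n =>
      Finsupp.mapRange.linearMap (DirectSum.lof k ℕ (fun n => X n) n) ∘ₗ
        Finsupp.lmapDomain (X n) k (fun q : ℤ => q + n) ∘ₗ (X n).comps
  refine isInternal_of_split _ (iSup_totalDeg X) Φ fun p x hx => ?_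
  have : totalDeg X p ≤ LinearMap.eqLocus Φ (Finsupp.lsingle p) := by
    refine totalDeg_le X fun n q h x hx => ?_
    simp [Φ, (X n).comps_of_mem hx, Finsupp.mapDomain_single, h]
  exact this hx

variable (hβ : ∀ (n : ℕ) (p : ℤ) (x : X n), x ∈ (X n).deg p → β n x ∈ (X (n + 1)).deg p)
  (hd : ∀ n, β n ∘ₗ (X n).d = (X (n + 1)).d ∘ₗ β n) (hββ : ∀ n, β (n + 1) ∘ₗ β n = 0)

/-- The total complex `⨁ n, X_n` of a sequence `X_0 → X_1 → X_2 → ⋯` of morphisms `β_n` of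
differential graded vector spaces with `β_{n+1} β_n = 0`; the summand `X_n` is shifted by `n`. -/
abbrev total : DGModule.{u, v} k where
  carrier := ⨁ n, X n
  deg := totalDeg X
  isInternal := isInternal_totalDeg X
  d := totalD X β
  d_mem := by
    intro p x hx
    have : totalDeg X p ≤ (totalDeg X (p + 1)).comap (totalD X β) := by
      refine totalDeg_le X fun n q h x hx => ?_
      rw [Submodule.mem_comap, totalD, DirectSum.toModule_lof]
      exact Submodule.add_mem _
        (Submodule.smul_mem _ _ (lof_mem_totalDeg X (by omega) ((X n).d_mem hx)))
        (lof_mem_totalDeg X (by push_cast; omega) (hβ n q x hx))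
    exact this hx
  d_comp_d := by
    refine DirectSum.linearMap_ext _ fun n => LinearMap.ext fun x => ?_
    have h1 : (X n).d ((X n).d x) = 0 := LinearMap.congr_fun (X n).d_comp_d x
    have h2 : β n ((X n).d x) = (X (n + 1)).d (β n x) := LinearMap.congr_fun (hd n) x
    have h3 : β (n + 1) (β n x) = 0 := LinearMap.congr_fun (hββ n) x
    simp [totalD, h1, h2, h3, pow_succ]

end Total

end DGModule

namespace DGCoalgebra

open DGModule

variable (C : DGCoalgebra.{u, v} k)

theorem comul_comp_parity : Coalgebra.comul (R := k) ∘ₗ C.parity =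
    TensorProduct.map C.parity C.parity ∘ₗ Coalgebra.comul (R := k) := by
  rw [← parity_tensor]
  exact comp_parity (V := C.toDGModule) (W := tensor C.toDGModule C.toDGModule)
    fun n x hx => C.comul_mem hx

theorem counit_comp_parity :
    Coalgebra.counit (R := k) ∘ₗ C.parity = Coalgebra.counit (R := k) (A := C.carrier) := by
  have h : ∀ (n : ℤ), C.deg n ≤ LinearMap.eqLocus (Coalgebra.counit (R := k) ∘ₗ C.parity)
      (Coalgebra.counit (R := k) (A := C.carrier)) := by
    intro n x hx
    rw [LinearMap.mem_eqLocus, LinearMap.comp_apply, C.parity_of_mem hx, map_smul]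
    by_cases hn : n = 0
    · simp [hn]
    · simp [C.counit_of_mem hx hn]
  refine LinearMap.ext fun x => (iSup_le h) ?_
  rw [C.isInternal.submodule_iSup_eq_top]
  exact Submodule.mem_top

/-- Coassociativity of `Δ ⊗ id`. -/
theorem comulTensor_comp_comulTensor (W : Type v) [AddCommGroup W] [Module k W] :
    C.comulTensor (C.carrier ⊗[k] W) ∘ₗ C.comulTensor W =
      TensorProduct.map LinearMap.id (C.comulTensor W) ∘ₗ C.comulTensor W := by
  refine TensorProduct.ext' fun c w => ?_
  let F : C.carrier ⊗[k] (C.carrier ⊗[k] C.carrier) →ₗ[k]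
      C.carrier ⊗[k] (C.carrier ⊗[k] (C.carrier ⊗[k] W)) :=
    TensorProduct.map LinearMap.id (TensorProduct.map LinearMap.id ((TensorProduct.mk k _ W).flip w))
  have h1 : ∀ t : C.carrier ⊗[k] C.carrier,
      C.comulTensor (C.carrier ⊗[k] W) (TensorProduct.assoc k _ _ _ (t ⊗ₜ[k] w)) =
        F (TensorProduct.assoc k _ _ _ (TensorProduct.map Coalgebra.comul LinearMap.id t)) := by
    intro t
    induction t with
    | zero => simp
    | add x y hx hy => simp only [TensorProduct.add_tmul, map_add, hx, hy]
    | tmul a b =>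
      simp only [comulTensor, TensorProduct.assoc_tmul, LinearMap.comp_apply, TensorProduct.map_tmul,
        LinearMap.id_apply, LinearEquiv.coe_coe]
      generalize (Coalgebra.comul (R := k) a) = s
      induction s with
      | zero => simp
      | add x y hx hy => simp only [TensorProduct.add_tmul, map_add, hx, hy]
      | tmul x y => simp [F]
  have h2 : ∀ t : C.carrier ⊗[k] C.carrier,
      TensorProduct.map LinearMap.id (C.comulTensor W) (TensorProduct.assoc k _ _ _ (t ⊗ₜ[k] w)) =
        F (TensorProduct.map LinearMap.id Coalgebra.comul t) := by
    intro t
    induction t with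
    | zero => simp
    | add x y hx hy => simp only [TensorProduct.add_tmul, map_add, hx, hy]
    | tmul a b =>
      simp only [comulTensor, TensorProduct.assoc_tmul, LinearMap.comp_apply, TensorProduct.map_tmul,
        LinearMap.id_apply, LinearEquiv.coe_coe, F]
      congr 1
      generalize (Coalgebra.comul (R := k) b) = s
      induction s with
      | zero => simp
      | add x y hx hy => simp only [TensorProduct.add_tmul, map_add, hx, hy]
      | tmul x y => simp
  have h3 := Coalgebra.coassoc_apply (R := k) c
  have h4 : C.comulTensor W (c ⊗ₜ[k] w) =
      TensorProduct.assoc k _ _ _ (Coalgebra.comul (R := k) c ⊗ₜ[k] w) := rfl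
  rw [LinearMap.comp_apply, LinearMap.comp_apply, h4, h1, h2]
  exact congrArg F h3

/-- Naturality of `Δ ⊗ id`. -/
theorem comulTensor_naturality {W W' : Type v} [AddCommGroup W] [Module k W] [AddCommGroup W']
    [Module k W'] (f : W →ₗ[k] W') :
    C.comulTensor W' ∘ₗ TensorProduct.map LinearMap.id f =
      TensorProduct.map LinearMap.id (TensorProduct.map LinearMap.id f) ∘ₗ C.comulTensor W := by
  refine TensorProduct.ext' fun c w => ?_
  simp only [comulTensor, LinearMap.comp_apply, TensorProduct.map_tmul, LinearMap.id_apply,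
    LinearEquiv.coe_coe]
  generalize (Coalgebra.comul (R := k) c) = s
  induction s with
  | zero => simp
  | add x y hx hy => simp only [TensorProduct.add_tmul, map_add, hx, hy]
  | tmul x y => simp

theorem comulTensor_mem (W : DGModule.{u, v} k) {n : ℤ} {x : C.carrier ⊗[k] W}
    (hx : x ∈ tensorDeg C.toDGModule W n) :
    C.comulTensor W x ∈ tensorDeg C.toDGModule (tensor C.toDGModule W) n := by
  have : tensorDeg C.toDGModule W n ≤
      (tensorDeg C.toDGModule (tensor C.toDGModule W) n).comap (C.comulTensor W) := by
    refine tensorDeg_le _ _ fun p q h x hx y hy => ?_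
    have h1 : tensorDeg C.toDGModule C.toDGModule p ≤
        (tensorDeg C.toDGModule (tensor C.toDGModule W) n).comap
          ((TensorProduct.assoc k C.carrier C.carrier W).toLinearMap ∘ₗ
            (TensorProduct.mk k _ W.carrier).flip y) := by
      refine tensorDeg_le _ _ fun p' q' h' x' hx' y' hy' => ?_
      exact tmul_mem _ _ (q := q' + q) (by omega) hx' (tmul_mem _ _ rfl hy' hy)
    exact h1 (C.comul_mem hx)
  exact this hx

theorem comulTensor_comp_d (W : DGModule.{u, v} k) :
    C.comulTensor W ∘ₗ tensorD C.toDGModule W =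
      tensorD C.toDGModule (tensor C.toDGModule W) ∘ₗ C.comulTensor W := by
  refine TensorProduct.ext' fun c w => ?_
  have h1 : Coalgebra.comul (R := k) (C.d c) =
      tensorD C.toDGModule C.toDGModule (Coalgebra.comul c) := LinearMap.congr_fun C.comul_comp_d c
  have h2 : Coalgebra.comul (R := k) (C.parity c) =
      TensorProduct.map C.parity C.parity (Coalgebra.comul (R := k) c) :=
    LinearMap.congr_fun C.comul_comp_parity c
  simp only [comulTensor, LinearMap.comp_apply, TensorProduct.map_tmul, LinearMap.id_apply,
    LinearEquiv.coe_coe, tensorD, LinearMap.add_apply, map_add, h1, h2]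
  generalize (Coalgebra.comul (R := k) c) = s
  induction s with
  | zero => simp
  | add x y hx hy =>
    simp only [TensorProduct.add_tmul, map_add] at hx hy ⊢
    rw [add_add_add_comm, add_add_add_comm (TensorProduct.map _ _ _), ← hx, ← hy]
    abel
  | tmul x y =>
    simp [TensorProduct.add_tmul, TensorProduct.tmul_add, add_assoc]

end DGCoalgebra

namespace DGPrecomodule

open DGModule

theorem map_id_comp_tensorD {V W W' : DGModule.{u, v} k} {f : W →ₗ[k] W'}
    (hf : f ∘ₗ W.d = W'.d ∘ₗ f) :
    TensorProduct.map LinearMap.id f ∘ₗ tensorD V W =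
      tensorD V W' ∘ₗ TensorProduct.map LinearMap.id f := by
  refine TensorProduct.ext' fun x y => ?_
  have h : f (W.d y) = W'.d (f y) := LinearMap.congr_fun hf y
  simp [tensorD, h]

theorem map_id_mem {V W W' : DGModule.{u, v} k} {f : W →ₗ[k] W'}
    (hf : ∀ n, ∀ x ∈ W.deg n, f x ∈ W'.deg n) {n : ℤ} {x : V ⊗[k] W}
    (hx : x ∈ tensorDeg V W n) :
    TensorProduct.map LinearMap.id f x ∈ tensorDeg V W' n :=
  map_mem_tensorDeg (a := 0) (b := 0) (fun n x hx => by simpa using hx)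
    (fun n x hx => by simpa using hf n x hx) (by omega) hx

theorem map_id_sub {A B B' : Type v} [AddCommGroup A] [Module k A] [AddCommGroup B] [Module k B]
    [AddCommGroup B'] [Module k B'] (f g : B →ₗ[k] B') :
    TensorProduct.map (LinearMap.id : A →ₗ[k] A) (f - g) =
      TensorProduct.map LinearMap.id f - TensorProduct.map LinearMap.id g :=
  LinearMap.lTensor_sub f g

theorem map_id_comp {A B B' B'' : Type v} [AddCommGroup A] [Module k A] [AddCommGroup B]
    [Module k B] [AddCommGroup B'] [Module k B'] [AddCommGroup B''] [Module k B'']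
    (g : B' →ₗ[k] B'') (f : B →ₗ[k] B') :
    TensorProduct.map (LinearMap.id : A →ₗ[k] A) (g ∘ₗ f) =
      TensorProduct.map LinearMap.id g ∘ₗ TensorProduct.map LinearMap.id f :=
  LinearMap.lTensor_comp A g f

/-- `Δ ⊗ id - id ⊗ b : C ⊗ W → C ⊗ (C ⊗ W)`, where `b : W → C ⊗ W` is the structure map of `W`. -/
def bar (W : DGPrecomodule.{u, v} C) :
    C.carrier ⊗[k] W.carrier →ₗ[k] C.carrier ⊗[k] (C.carrier ⊗[k] W.carrier) :=
  C.comulTensor W.carrier - TensorProduct.map LinearMap.id W.coact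

theorem bar_comp_coact (W : DGPrecomodule.{u, v} C) : W.bar ∘ₗ W.coact = 0 := by
  rw [bar, LinearMap.sub_comp, W.coassoc, sub_self]

theorem comulTensor_comp_bar (W : DGPrecomodule.{u, v} C) :
    C.comulTensor (C.carrier ⊗[k] W.carrier) ∘ₗ W.bar =
      TensorProduct.map LinearMap.id W.bar ∘ₗ C.comulTensor W.carrier := by
  rw [bar, map_id_sub, LinearMap.comp_sub, LinearMap.sub_comp, C.comulTensor_comp_comulTensor,
    C.comulTensor_naturality]

theorem bar_mem (W : DGPrecomodule.{u, v} C) {n : ℤ} {x : C.carrier ⊗[k] W.carrier}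
    (hx : x ∈ tensorDeg C.toDGModule W.toDGModule n) :
    W.bar x ∈ tensorDeg C.toDGModule (tensor C.toDGModule W.toDGModule) n :=
  Submodule.sub_mem _ (C.comulTensor_mem W.toDGModule hx)
    (map_id_mem (W' := tensor C.toDGModule W.toDGModule) (fun _ _ h => W.coact_mem h) hx)

theorem bar_comp_d (W : DGPrecomodule.{u, v} C) :
    W.bar ∘ₗ tensorD C.toDGModule W.toDGModule =
      tensorD C.toDGModule (tensor C.toDGModule W.toDGModule) ∘ₗ W.bar := by
  rw [bar, LinearMap.sub_comp, LinearMap.comp_sub, C.comulTensor_comp_d W.toDGModule,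
    map_id_comp_tensorD (W' := tensor C.toDGModule W.toDGModule) W.coact_comp_d]

/-- For `W` with structure map `b : W → C ⊗ W`, the space `C ⊗ W` with the structure map
`Δ ⊗ id - id ⊗ b : C ⊗ W → C ⊗ (C ⊗ W)`. -/
abbrev step (W : DGPrecomodule.{u, v} C) : DGPrecomodule.{u, v} C where
  toDGModule := tensor C.toDGModule W.toDGModule
  coact := W.bar
  coact_mem := W.bar_mem
  coact_comp_d := W.bar_comp_d
  coassoc := by
    have h : TensorProduct.map (LinearMap.id : C.carrier →ₗ[k] C.carrier) W.bar ∘ₗ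
        TensorProduct.map LinearMap.id W.coact = 0 := by
      rw [← map_id_comp, W.bar_comp_coact, TensorProduct.map_zero_right]
    rw [W.comulTensor_comp_bar]
    conv_rhs => rw [bar, LinearMap.comp_sub]
    exact (sub_eq_self.2 h).symm

/-- `C ⊗ f : C ⊗ W → C ⊗ W'`. -/
abbrev stepMap {W W' : DGPrecomodule.{u, v} C} (f : Hom W W') : Hom W.step W'.step where
  lin := TensorProduct.map LinearMap.id f.lin
  map_mem := fun hx => map_id_mem (fun _ _ h => f.map_mem h) hx
  comp_d := map_id_comp_tensorD f.comp_d
  colinear := by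
    change W'.bar ∘ₗ _ = _ ∘ₗ W.bar
    rw [bar, bar, LinearMap.sub_comp, LinearMap.comp_sub, C.comulTensor_naturality,
      ← map_id_comp, ← map_id_comp, f.colinear]

end DGPrecomodule

namespace DGComodule

open DGModule

/-- `C^{⊗ n} ⊗ M` (with `C^{⊗ (n + 1)} ⊗ M = C ⊗ (C^{⊗ n} ⊗ M)`), together with the map
`b' : C^{⊗ n} ⊗ M → C^{⊗ (n + 1)} ⊗ M`,
`b' (c_1, …, c_n, m) = ∑_{i = 1}^{n + 1} (-1)^{i + 1} (c_1, …, Δ c_i, …, c_n, m)`,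
where `c_{n + 1} = m` and `Δ m = ρ m`, as its structure map. -/
def power (M : DGComodule.{u, v} C) : ℕ → DGPrecomodule.{u, v} C
  | 0 => M.toDGPrecomodule
  | n + 1 => (power M n).step

/-- The map `C^{⊗ n} ⊗ M → C^{⊗ n} ⊗ N` induced by `M → N`. -/
def powerMap {M N : DGComodule.{u, v} C} (f : M ⟶ N) :
    ∀ n : ℕ, DGPrecomodule.Hom (M.power n) (N.power n)
  | 0 => f
  | n + 1 => DGPrecomodule.stepMap (powerMap f n)

/-- The summand `C^{⊗ (n + 1)} ⊗ M = C ⊗ (C^{⊗ n} ⊗ M)` of the standard resolution. -/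
abbrev summand (M : DGComodule.{u, v} C) (n : ℕ) : DGModule.{u, v} k :=
  tensor C.toDGModule (M.power n).toDGModule

/-- The map `b'` from `C^{⊗ (n + 1)} ⊗ M` to `C^{⊗ (n + 2)} ⊗ M`. -/
def bPrime (M : DGComodule.{u, v} C) (n : ℕ) : M.summand n →ₗ[k] M.summand (n + 1) :=
  (M.power n).bar

/-- The inclusion of the summand `C^{⊗ (n + 1)} ⊗ M`. -/
abbrev incl (M : DGComodule.{u, v} C) (n : ℕ) : M.summand n →ₗ[k] ⨁ n, M.summand n :=
  DirectSum.lof k ℕ (fun n => M.summand n) n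

/-- The complex underlying the standard resolution: `⨁_{n ≥ 0} C^{⊗ (n + 1)} ⊗ M`, where
`(c_1, …, c_{n + 1}, m)` has degree `|c_1| + ⋯ + |c_{n + 1}| + |m| + n`, with differential
`(-1)^n d + b'` on the summand of index `n`. -/
abbrev cobarComplex (M : DGComodule.{u, v} C) : DGModule.{u, v} k :=
  DGModule.total M.summand M.bPrime
    (fun n _ _ hx => (M.power n).bar_mem hx)
    (fun n => (M.power n).bar_comp_d)
    (fun n => (M.power (n + 1)).bar_comp_coact)

/-- The coaction of the standard resolution,
`(c_1, …, c_{n + 1}, m) ↦ ∑ (-1)^{n |c_1'|} c_1' ⊗ (c_1'', c_2, …, c_{n + 1}, m)`; the sign is the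
Koszul sign that comes from the shift by `n`. -/
def cobarCoact (M : DGComodule.{u, v} C) :
    (⨁ n, M.summand n) →ₗ[k] C.carrier ⊗[k] ⨁ n, M.summand n :=
  DirectSum.toModule k ℕ _ fun n =>
    TensorProduct.map (C.parity ^ n) (M.incl n) ∘ₗ C.comulTensor (M.power n).carrier

theorem cobarCoact_incl (M : DGComodule.{u, v} C) (n : ℕ) (x : M.summand n) :
    M.cobarCoact (M.incl n x) = TensorProduct.map (C.parity ^ n) (M.incl n)
      (C.comulTensor (M.power n).carrier x) := by
  rw [cobarCoact, DirectSum.toModule_lof, LinearMap.comp_apply]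

theorem cobarComplex_d_incl (M : DGComodule.{u, v} C) (n : ℕ) (x : M.summand n) :
    M.cobarComplex.d (M.incl n x) =
      (-1 : k) ^ n • M.incl n ((M.summand n).d x) + M.incl (n + 1) (M.bPrime n x) := by
  change totalD _ _ _ = _
  rw [totalD, DirectSum.toModule_lof]
  rfl

theorem parity_pow_mem (V : DGModule.{u, v} k) (j : ℕ) {n : ℤ} {x : V} (hx : x ∈ V.deg n) :
    (V.parity ^ j) x ∈ V.deg n := by
  induction j with
  | zero => simpa using hx
  | succ j ih => rw [pow_succ', Module.End.mul_apply]; exact V.parity_mem ih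

theorem parity_pow_d (V : DGModule.{u, v} k) (j : ℕ) (x : V) :
    (V.parity ^ j) (V.d x) = (-1 : k) ^ j • V.d ((V.parity ^ j) x) := by
  induction j with
  | zero => simp
  | succ j ih =>
    have h : ∀ y, V.parity (V.d y) = -V.d (V.parity y) := LinearMap.congr_fun V.parity_comp_d
    simp [pow_succ', ih, h]

theorem cobarCoact_mem (M : DGComodule.{u, v} C) {p : ℤ} {x : ⨁ n, M.summand n}
    (hx : x ∈ totalDeg M.summand p) :
    M.cobarCoact x ∈ tensorDeg C.toDGModule M.cobarComplex p := by
  have : totalDeg M.summand p ≤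
      (tensorDeg C.toDGModule M.cobarComplex p).comap M.cobarCoact := by
    refine totalDeg_le _ fun n q h x hx => ?_
    rw [Submodule.mem_comap, cobarCoact, DirectSum.toModule_lof]
    exact map_mem_tensorDeg (a := 0) (b := n) (W' := M.cobarComplex)
      (fun m x hx => by simpa using parity_pow_mem C.toDGModule n hx)
      (fun m x hx => lof_mem_totalDeg M.summand rfl hx) (by omega)
      (C.comulTensor_mem (M.power n).toDGModule hx)
  exact this hx

theorem cobarCoact_comp_d (M : DGComodule.{u, v} C) :
    M.cobarCoact ∘ₗ M.cobarComplex.d =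
      tensorD C.toDGModule M.cobarComplex ∘ₗ M.cobarCoact := by
  refine DirectSum.linearMap_ext _ fun n => LinearMap.ext fun x => ?_
  have h1 : C.comulTensor (M.power n).carrier (tensorD C.toDGModule (M.power n).toDGModule x) =
      tensorD C.toDGModule (M.summand n) (C.comulTensor (M.power n).carrier x) :=
    LinearMap.congr_fun (C.comulTensor_comp_d (M.power n).toDGModule) x
  have h2 : C.comulTensor (M.power (n + 1)).carrier (M.bPrime n x) =
      TensorProduct.map LinearMap.id (M.bPrime n) (C.comulTensor (M.power n).carrier x) :=
    LinearMap.congr_fun (M.power n).comulTensor_comp_bar x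
  simp only [LinearMap.comp_apply, totalD, cobarCoact, DirectSum.toModule_lof, LinearMap.add_apply,
    LinearMap.smul_apply, map_add, map_smul, h1, h2]
  generalize C.comulTensor (M.power n).carrier x = s
  induction s with
  | zero => simp
  | add x y hx hy =>
    simp only [map_add, smul_add] at hx hy ⊢
    rw [add_add_add_comm, hx, hy]
  | tmul a b =>
    have h3 := parity_pow_d C.toDGModule n a
    have h4 : (C.parity ^ n) (C.parity a) = C.parity ((C.parity ^ n) a) := by
      rw [← Module.End.mul_apply, ← Module.End.mul_apply, ← pow_succ, ← pow_succ']
    have h5 : (-1 : k) ^ n * (-1 : k) ^ n = 1 := by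
      rw [← mul_pow]; simp
    simp only [tensorD, LinearMap.add_apply, TensorProduct.map_tmul, LinearMap.id_apply, map_add,
      smul_add, h3, h4, TensorProduct.smul_tmul', smul_smul, h5, one_smul, totalD,
      DirectSum.toModule_lof, LinearMap.smul_apply, LinearMap.comp_apply, TensorProduct.tmul_add,
      TensorProduct.tmul_smul, pow_succ', Module.End.mul_apply, add_assoc]

theorem comul_parity_pow (C : DGCoalgebra.{u, v} k) (j : ℕ) (a : C.carrier) :
    Coalgebra.comul (R := k) ((C.parity ^ j) a) =
      TensorProduct.map (C.parity ^ j) (C.parity ^ j) (Coalgebra.comul (R := k) a) := by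
  induction j with
  | zero => simp [Module.End.one_eq_id]
  | succ j ih =>
    have h : ∀ y, Coalgebra.comul (R := k) (C.parity y) =
      TensorProduct.map C.parity C.parity (Coalgebra.comul (R := k) y) :=
      LinearMap.congr_fun C.comul_comp_parity
    rw [pow_succ', Module.End.mul_apply, h, ih, Module.End.mul_eq_comp, TensorProduct.map_comp,
      LinearMap.comp_apply]

theorem counit_parity_pow (C : DGCoalgebra.{u, v} k) (j : ℕ) (a : C.carrier) :
    Coalgebra.counit (R := k) ((C.parity ^ j) a) = Coalgebra.counit (R := k) a := by
  induction j with
  | zero => simp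
  | succ j ih =>
    have h : ∀ y, Coalgebra.counit (R := k) (C.parity y) = Coalgebra.counit (R := k) y :=
      LinearMap.congr_fun C.counit_comp_parity
    rw [pow_succ', Module.End.mul_apply, h, ih]

theorem cobarCoact_coassoc (M : DGComodule.{u, v} C) :
    C.comulTensor (⨁ n, M.summand n) ∘ₗ M.cobarCoact =
      TensorProduct.map LinearMap.id M.cobarCoact ∘ₗ M.cobarCoact := by
  refine DirectSum.linearMap_ext _ fun n => LinearMap.ext fun x => ?_
  have h1 : C.comulTensor (C.carrier ⊗[k] (M.power n).carrier) (C.comulTensor (M.power n).carrier x) =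
      TensorProduct.map LinearMap.id (C.comulTensor (M.power n).carrier)
        (C.comulTensor (M.power n).carrier x) :=
    LinearMap.congr_fun (C.comulTensor_comp_comulTensor (M.power n).carrier) x
  have h2 : ∀ s : C.carrier ⊗[k] (M.summand n).carrier,
      C.comulTensor (⨁ n, M.summand n) (TensorProduct.map (C.parity ^ n) (M.incl n) s) =
        TensorProduct.map (C.parity ^ n) (TensorProduct.map (C.parity ^ n) (M.incl n))
          (C.comulTensor (M.summand n).carrier s) := by
    intro s
    induction s with
    | zero => simp
    | add x y hx hy => simp only [map_add, hx, hy]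
    | tmul a b =>
      simp only [DGCoalgebra.comulTensor, LinearMap.comp_apply, TensorProduct.map_tmul,
        LinearMap.id_apply, LinearEquiv.coe_coe, comul_parity_pow]
      generalize (Coalgebra.comul (R := k) a) = t
      induction t with
      | zero => simp
      | add x y hx hy => simp only [TensorProduct.add_tmul, map_add, hx, hy]
      | tmul x y => simp
  have h3 : ∀ s : C.carrier ⊗[k] (M.summand n).carrier,
      TensorProduct.map LinearMap.id M.cobarCoact (TensorProduct.map (C.parity ^ n) (M.incl n) s) =
        TensorProduct.map (C.parity ^ n) (TensorProduct.map (C.parity ^ n) (M.incl n))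
          (TensorProduct.map LinearMap.id (C.comulTensor (M.power n).carrier) s) := by
    intro s
    induction s with
    | zero => simp
    | add x y hx hy => simp only [map_add, hx, hy]
    | tmul a b =>
      simp only [TensorProduct.map_tmul, LinearMap.id_apply, cobarCoact, DirectSum.toModule_lof,
        LinearMap.comp_apply]
  have h4 := M.cobarCoact_incl n x
  rw [LinearMap.comp_apply, LinearMap.comp_apply, LinearMap.comp_apply, LinearMap.comp_apply, h4,
    h2, h3]
  exact congrArg _ h1

/-- The standard resolution `C(M)`. -/
def cobar (M : DGComodule.{u, v} C) : DGComodule.{u, v} C where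
  toDGModule := M.cobarComplex
  coact := M.cobarCoact
  coact_mem := M.cobarCoact_mem
  coact_comp_d := M.cobarCoact_comp_d
  coassoc := M.cobarCoact_coassoc
  counit_coact := by
    refine DirectSum.linearMap_ext _ fun n => TensorProduct.ext' fun c w => ?_
    have h4 := M.cobarCoact_incl n (c ⊗ₜ[k] w)
    have h5 : ∀ t : C.carrier ⊗[k] C.carrier,
        TensorProduct.lid k _ (TensorProduct.map Coalgebra.counit LinearMap.id
          (TensorProduct.map (C.parity ^ n) (M.incl n)
            (TensorProduct.assoc k _ _ _ (t ⊗ₜ[k] w)))) =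
          M.incl n (TensorProduct.lid k _
            (TensorProduct.map Coalgebra.counit LinearMap.id t) ⊗ₜ[k] w) := by
      intro t
      induction t with
      | zero => simp
      | add x y hx hy => simp only [TensorProduct.add_tmul, map_add, hx, hy]
      | tmul x y =>
        simp only [TensorProduct.assoc_tmul, TensorProduct.map_tmul, counit_parity_pow,
          LinearMap.id_apply, TensorProduct.lid_tmul, ← TensorProduct.smul_tmul', map_smul]
    have h6 : TensorProduct.lid k _ (TensorProduct.map Coalgebra.counit LinearMap.id
        (Coalgebra.comul (R := k) c)) = c := by
      have := Coalgebra.rTensor_counit_comul (R := k) c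
      rw [LinearMap.rTensor] at this
      rw [this, TensorProduct.lid_tmul, one_smul]
    simp only [LinearMap.comp_apply, h4, LinearEquiv.coe_coe, LinearMap.id_apply]
    refine (h5 _).trans ?_
    rw [h6]

/-- The linear map underlying `C(M) → C(N)` for a morphism `f : M → N`, which is
`⨁ n, C^{⊗ (n + 1)} ⊗ f`. -/
def cobarMapLin {M N : DGComodule.{u, v} C} (f : M ⟶ N) :
    (⨁ n, M.summand n) →ₗ[k] ⨁ n, N.summand n :=
  DirectSum.toModule k ℕ _ fun n =>
    N.incl n ∘ₗ TensorProduct.map LinearMap.id (powerMap f n).lin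

theorem cobarMapLin_incl {M N : DGComodule.{u, v} C} (f : M ⟶ N) (n : ℕ) (x : M.summand n) :
    cobarMapLin f (M.incl n x) =
      N.incl n (TensorProduct.map LinearMap.id (powerMap f n).lin x) := by
  rw [cobarMapLin, DirectSum.toModule_lof, LinearMap.comp_apply]

/-- The morphism `C(M) → C(N)` induced by `M → N`. -/
def cobarMap {M N : DGComodule.{u, v} C} (f : M ⟶ N) : M.cobar ⟶ N.cobar where
  lin := cobarMapLin f
  map_mem := by
    intro p x hx
    have : totalDeg M.summand p ≤ (totalDeg N.summand p).comap (cobarMapLin f) := by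
      refine totalDeg_le _ fun n q h x hx => ?_
      rw [Submodule.mem_comap, cobarMapLin_incl]
      exact lof_mem_totalDeg N.summand h ((DGPrecomodule.stepMap (powerMap f n)).map_mem hx)
    exact this hx
  comp_d := by
    refine DirectSum.linearMap_ext _ fun n => LinearMap.ext fun x => ?_
    have h1 : TensorProduct.map LinearMap.id (powerMap f n).lin ((M.summand n).d x) =
        (N.summand n).d (TensorProduct.map LinearMap.id (powerMap f n).lin x) :=
      LinearMap.congr_fun (DGPrecomodule.stepMap (powerMap f n)).comp_d x
    have h2 : TensorProduct.map LinearMap.id (powerMap f (n + 1)).lin (M.bPrime n x) =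
        N.bPrime n (TensorProduct.map LinearMap.id (powerMap f n).lin x) :=
      (LinearMap.congr_fun (DGPrecomodule.stepMap (powerMap f n)).colinear x).symm
    change cobarMapLin f (M.cobarComplex.d (M.incl n x)) =
      N.cobarComplex.d (cobarMapLin f (M.incl n x))
    rw [cobarMapLin_incl, cobarComplex_d_incl, cobarComplex_d_incl, map_add, map_smul,
      cobarMapLin_incl, cobarMapLin_incl, h1, h2]
  colinear := by
    refine DirectSum.linearMap_ext _ fun n => LinearMap.ext fun x => ?_
    have h1 := LinearMap.congr_fun (C.comulTensor_naturality (powerMap f n).lin) x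
    change N.cobarCoact (cobarMapLin f (M.incl n x)) =
      TensorProduct.map LinearMap.id (cobarMapLin f) (M.cobarCoact (M.incl n x))
    rw [cobarMapLin_incl, cobarCoact_incl, cobarCoact_incl]
    refine (congrArg _ h1).trans ?_
    rw [LinearMap.comp_apply]
    generalize C.comulTensor (M.power n).carrier x = s
    induction s with
    | zero => simp
    | add x y hx hy => simp only [map_add, hx, hy]
    | tmul a b =>
      simp only [TensorProduct.map_tmul, LinearMap.id_apply]
      rw [cobarMapLin_incl]

/-- The coaction `ρ : M → C ⊗ M`, with values in the first summand of `C(M)`. -/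
def coactZero (M : DGComodule.{u, v} C) : M.carrier →ₗ[k] M.summand 0 := M.coact

/-- The morphism `M → C ⊗ M ⊆ C(M)` given by the coaction of `M`. -/
def cobarUnit (M : DGComodule.{u, v} C) : M ⟶ M.cobar where
  lin := M.incl 0 ∘ₗ M.coactZero
  map_mem := fun hx => lof_mem_totalDeg M.summand (n := 0) (by simp) (M.coact_mem hx)
  comp_d := by
    refine LinearMap.ext fun x => ?_
    have h1 : M.coactZero (M.d x) = (M.summand 0).d (M.coactZero x) :=
      LinearMap.congr_fun M.coact_comp_d x
    have h2 : M.bPrime 0 (M.coactZero x) = 0 :=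
      LinearMap.congr_fun M.toDGPrecomodule.bar_comp_coact x
    change M.incl 0 (M.coactZero (M.d x)) = M.cobarComplex.d (M.incl 0 (M.coactZero x))
    rw [cobarComplex_d_incl, h1, h2]
    simp
  colinear := by
    refine LinearMap.ext fun x => ?_
    have h1 : C.comulTensor (M.power 0).carrier (M.coactZero x) =
        TensorProduct.map LinearMap.id M.coactZero (M.coact x) := LinearMap.congr_fun M.coassoc x
    change M.cobarCoact (M.incl 0 (M.coactZero x)) =
      TensorProduct.map LinearMap.id (M.incl 0 ∘ₗ M.coactZero) (M.coact x)
    rw [cobarCoact_incl, h1, DGPrecomodule.map_id_comp, pow_zero, Module.End.one_eq_id]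
    rfl

theorem powerMap_id (M : DGComodule.{u, v} C) (n : ℕ) :
    (powerMap (𝟙 M) n).lin = LinearMap.id := by
  induction n with
  | zero => rfl
  | succ n ih =>
    change TensorProduct.map LinearMap.id (powerMap (𝟙 M) n).lin = LinearMap.id
    rw [ih, TensorProduct.map_id]

theorem powerMap_comp {M N P : DGComodule.{u, v} C} (f : M ⟶ N) (g : N ⟶ P) (n : ℕ) :
    (powerMap (f ≫ g) n).lin = (powerMap g n).lin ∘ₗ (powerMap f n).lin := by
  induction n with
  | zero => rfl
  | succ n ih =>
    change TensorProduct.map LinearMap.id (powerMap (f ≫ g) n).lin = _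
    rw [ih, DGPrecomodule.map_id_comp]
    rfl

end DGComodule

/-- The standard resolution as a functor `Chain(C) ⥤ Chain(C)`. -/
def cobarFunctor (C : DGCoalgebra.{u, v} k) : DGComodule.{u, v} C ⥤ DGComodule.{u, v} C where
  obj M := M.cobar
  map f := DGComodule.cobarMap f
  map_id M := by
    refine DGPrecomodule.Hom.ext (DirectSum.linearMap_ext _ fun n => LinearMap.ext fun x => ?_)
    change DGComodule.cobarMapLin (𝟙 M) (M.incl n x) = M.incl n x
    rw [DGComodule.cobarMapLin_incl, DGComodule.powerMap_id, TensorProduct.map_id,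
      LinearMap.id_apply]
  map_comp {M N P} f g := by
    refine DGPrecomodule.Hom.ext (DirectSum.linearMap_ext _ fun n => LinearMap.ext fun x => ?_)
    change DGComodule.cobarMapLin (f ≫ g) (M.incl n x) =
      DGComodule.cobarMapLin g (DGComodule.cobarMapLin f (M.incl n x))
    rw [DGComodule.cobarMapLin_incl, DGComodule.cobarMapLin_incl, DGComodule.cobarMapLin_incl,
      DGComodule.powerMap_comp, DGPrecomodule.map_id_comp, LinearMap.comp_apply]

/-- The natural morphism `M → C(M)`. -/
def cobarNat (C : DGCoalgebra.{u, v} k) :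
    𝟭 (DGComodule.{u, v} C) ⟶ cobarFunctor C where
  app M := M.cobarUnit
  naturality {M N} f := by
    refine DGPrecomodule.Hom.ext (LinearMap.ext fun x => ?_)
    have h : N.coactZero (f.lin x) =
        TensorProduct.map LinearMap.id (DGComodule.powerMap f 0).lin (M.coactZero x) :=
      LinearMap.congr_fun f.colinear x
    change N.incl 0 (N.coactZero (f.lin x)) = DGComodule.cobarMapLin f (M.incl 0 (M.coactZero x))
    rw [DGComodule.cobarMapLin_incl, h]

end DGCo

end

noncomputable section

open CategoryTheory TensorProduct DirectSum

/-! Closedness of `C(M)` reduces to a statement inside `H(C)`: if precomposition with every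
quasi-isomorphism is bijective on homotopy classes of morphisms into `X`, then localizing does not
change morphisms into `X` (`bijective_Q_map_of_isLocal`). With mapping cones, both injectivity and
surjectivity of this precomposition follow from one vanishing statement,
`exists_homD_eq_of_acyclic`: for `A` acyclic and `M` left bounded, every closed graded colinear map
`A → C(M)` of degree `p` is a boundary. Degree `0` gives injectivity and degree `1` gives
surjectivity.

The vanishing statement is proved along the filtration of `C(M)` by tensor length. On the `j`-th
graded piece `C ⊗ (C^{⊗ j} ⊗ M)` only the internal differential survives, and this piece is cofree,
so colinear maps into it are the same as `k`-linear maps `A → C^{⊗ j} ⊗ M`. Since `k` is a field,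
the acyclic complex `A` has a `k`-linear contraction `s`, and composing with `s` writes any closed
linear map as a boundary. Thus a closed map can be pushed one filtration step deeper by subtracting
a boundary (`exists_cofreeLift_sub_mem`). Positivity of `C` and boundedness of `M` put the summand
of index `j`, which is shifted by `j`, in degrees `≥ n₀ + j`. In a fixed degree the filtration is
therefore eventually zero, and the infinite sum of corrections is finite on each element
(`exists_homD_eq`).

That `M → C(M)` is a quasi-isomorphism needs no boundedness: the counit on the first tensor factor
is a `k`-linear contraction of `C(M)` onto `M` (`d_cobarContraction`). For the equivalence,
closedness of the target gives full faithfulness, and the resolution gives essential surjectivity.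
-/

namespace DGCo

/-! ### Morphisms into local objects of a localization. -/

/-- If `Hom(-, X)` inverts `W`, then localizing at `W` does not change the morphisms to `X`. -/
theorem bijective_Q_map_of_isLocal {H : Type*} [Category H] (W : MorphismProperty H) (X : H)
    (hX : ∀ ⦃A B : H⦄ (s : A ⟶ B), W s → Function.Bijective fun g : B ⟶ X => s ≫ g) (N : H) :
    Function.Bijective fun φ : N ⟶ X => W.Q.map φ := by
  have hinv : W.IsInvertedBy (yoneda.obj X).rightOp := fun A B s hs => by
    have : IsIso ((yoneda.obj X).map s.op) := (isIso_iff_bijective _).2 (hX s hs)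
    change IsIso ((yoneda.obj X).map s.op).op
    infer_instance
  constructor
  · intro f g hfg
    -- `Hom(-, X)` factors through the localization, so it takes the same value on `f` and `g`;
    -- evaluating at `𝟙 X` recovers them.
    have h : (yoneda.obj X).rightOp.map f = (yoneda.obj X).rightOp.map g :=
      congrArg (Localization.Construction.lift (yoneda.obj X).rightOp hinv).map hfg
    have h' : (yoneda.obj X).map f.op = (yoneda.obj X).map g.op := congrArg Quiver.Hom.unop h
    simpa using ConcreteCategory.congr_hom h' (𝟙 X)
  · intro φ
    -- A morphism of the localization is a composite of images of arrows and formal inverses of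
    -- arrows in `W`. The property "pulls back maps to `X` coming from `H` to maps coming from `H`"
    -- holds for both kinds and is stable under composition, hence always holds; for `φ` it is
    -- applied to `𝟙 X`.
    let P : MorphismProperty W.Localization := fun A B φ =>
      ∀ f : B.as.obj ⟶ X, ∃ f' : A.as.obj ⟶ X, W.Q.map f' = φ ≫ W.Q.map f
    have : P.IsStableUnderComposition := ⟨fun φ ψ hφ hψ f => by
      obtain ⟨f', hf'⟩ := hψ f
      obtain ⟨f'', hf''⟩ := hφ f'
      exact ⟨f'', hf''.trans ((congrArg (φ ≫ ·) hf').trans (Category.assoc φ ψ _).symm)⟩⟩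
    have hP : P = ⊤ := by
      refine Localization.Construction.morphismProperty_eq_top P (fun A B s f => ?_)
        fun A B s hs f => ?_
      · exact ⟨s ≫ f, W.Q.map_comp s f⟩
      · obtain ⟨f', hf'⟩ := (hX s hs).2 f
        subst hf'
        exact ⟨f', (Iso.eq_inv_comp (Localization.Construction.wIso s hs)).2 (W.Q.map_comp s f').symm⟩
    have hφ : P φ := hP ▸ MorphismProperty.top_apply φ
    obtain ⟨f', hf'⟩ := hφ (𝟙 X)
    exact ⟨f', hf'.trans ((congrArg (φ ≫ ·) (W.Q.map_id X)).trans (Category.comp_id φ))⟩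

/-! ### Homogeneous components and contractions over a field. -/

namespace DGModule

variable {k : Type u} [Field k]

theorem comps_apply_mem (V : DGModule.{u, v} k) (x : V) (n : ℤ) : V.comps x n ∈ V.deg n := by
  have h : (⊤ : Submodule k V) ≤ (V.deg n).comap (Finsupp.lapply n ∘ₗ V.comps) := by
    rw [← V.isInternal.submodule_iSup_eq_top]
    refine iSup_le fun m x hx => ?_
    rw [Submodule.mem_comap, LinearMap.comp_apply, V.comps_of_mem hx, Finsupp.lapply_apply,
      Finsupp.single_apply]
    split_ifs with h
    · exact h ▸ hx
    · exact Submodule.zero_mem _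
  exact h Submodule.mem_top

theorem comps_d (V : DGModule.{u, v} k) (x : V) (n : ℤ) :
    V.comps (V.d x) (n + 1) = V.d (V.comps x n) := by
  have : Finsupp.lapply (n + 1) ∘ₗ V.comps ∘ₗ V.d = V.d ∘ₗ Finsupp.lapply n ∘ₗ V.comps := by
    refine V.hom_ext fun m x hx => ?_
    simp only [LinearMap.comp_apply, V.comps_of_mem hx, V.comps_of_mem (V.d_mem hx),
      Finsupp.lapply_apply, Finsupp.single_apply, add_left_inj]
    split_ifs <;> simp
  exact LinearMap.congr_fun this x

/-- An acyclic differential graded vector space has a graded contraction. -/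
theorem exists_contraction (V : DGModule.{u, v} k) (hV : LinearMap.ker V.d ≤ LinearMap.range V.d) :
    ∃ s : V →ₗ[k] V, (∀ n, ∀ x ∈ V.deg n, s x ∈ V.deg (n - 1)) ∧
      V.d ∘ₗ s + s ∘ₗ V.d = LinearMap.id := by
  -- Over a field `d` splits onto its image, and the splitting extends to all of `V`; this gives `d
  -- s₀ d = d`, without control of degrees.
  obtain ⟨r, hr⟩ := LinearMap.exists_rightInverse_of_surjective V.d.rangeRestrict
    V.d.range_rangeRestrict
  obtain ⟨s₀, hs₀⟩ := LinearMap.exists_extend r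
  have h₀ : ∀ x, V.d (s₀ (V.d x)) = V.d x := fun x => by
    have h1 : s₀ (V.d x) = r (V.d.rangeRestrict x) := LinearMap.congr_fun hs₀ (V.d.rangeRestrict x)
    rw [h1]
    exact congrArg Subtype.val (LinearMap.congr_fun hr (V.d.rangeRestrict x))
  -- The part of `s₀` that is homogeneous of degree `-1`; `d s₁ d = d` persists because `d` is
  -- homogeneous.
  let s₁ : V →ₗ[k] V :=
    Finsupp.lsum k (fun n : ℤ => Finsupp.lapply (n - 1) ∘ₗ V.comps ∘ₗ s₀) ∘ₗ V.comps
  have hs₁ : ∀ n, ∀ x ∈ V.deg n, s₁ x = V.comps (s₀ x) (n - 1) := fun n x hx => by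
    simp [s₁, V.comps_of_mem hx]
  have h₁ : V.d ∘ₗ s₁ ∘ₗ V.d = V.d := by
    refine V.hom_ext fun n x hx => ?_
    rw [LinearMap.comp_apply, LinearMap.comp_apply, hs₁ _ _ (V.d_mem hx), ← comps_d, h₀,
      sub_add_cancel, V.comps_of_mem (V.d_mem hx), Finsupp.single_eq_same]
  have hdd : ∀ x, V.d (V.d x) = 0 := LinearMap.congr_fun V.d_comp_d
  have hmem : ∀ n, ∀ x ∈ V.deg n, s₁ x ∈ V.deg (n - 1) := fun n x hx => by
    rw [hs₁ n x hx]; exact V.comps_apply_mem _ _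
  -- The element `x - s₁ d x` is a cycle, hence some `d y` by acyclicity, and `d s₁` fixes
  -- boundaries. The term `s d x` is just `s₁ d x` since `d² = 0`.
  refine ⟨s₁ ∘ₗ (LinearMap.id - s₁ ∘ₗ V.d), fun n x hx => ?_, LinearMap.ext fun x => ?_⟩
  · refine hmem n _ (Submodule.sub_mem _ hx ?_)
    have := hmem _ _ (V.d_mem hx)
    rwa [add_sub_cancel_right] at this
  · have h2 : V.d (s₁ (V.d x)) = V.d x := LinearMap.congr_fun h₁ x
    obtain ⟨y, hy⟩ := hV (show x - s₁ (V.d x) ∈ LinearMap.ker V.d by simp [h2])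
    have h3 : V.d (s₁ (V.d y)) = V.d y := LinearMap.congr_fun h₁ y
    rw [hy] at h3
    simp only [LinearMap.add_apply, LinearMap.comp_apply, LinearMap.sub_apply, LinearMap.id_apply,
      h3, hdd, map_zero, sub_zero, sub_add_cancel]

end DGModule

/-! ### Graded colinear maps and the differential on them. -/

open DGModule

variable {k : Type u} [Field k] {C : DGCoalgebra.{u, v} k}

theorem neg_one_pow_mul_self (n : ℕ) : (-1 : k) ^ n * (-1 : k) ^ n = 1 := by
  rw [← mul_pow]; simp

theorem DGModule.parity_pow_mul_self (V : DGModule.{u, v} k) (n : ℕ) :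
    V.parity ^ n * V.parity ^ n = 1 := by
  rw [← pow_add, ← two_mul, pow_mul, sq]
  have : V.parity * V.parity = 1 := V.parity_comp_parity
  rw [this, one_pow]

/-- `f : A → X` is a graded map of degree `p`, colinear with the Koszul sign
`ρ (f a) = ∑ (-1)^{q |c|} c ⊗ f a'` for `ρ a = ∑ c ⊗ a'`. -/
structure IsGradedColinear {A X : DGComodule.{u, v} C} (p : ℤ) (q : ℕ)
    (f : A.carrier →ₗ[k] X.carrier) : Prop where
  map_mem : ∀ (n : ℤ) (x : A.carrier), x ∈ A.deg n → f x ∈ X.deg (n + p)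
  colinear : X.coact ∘ₗ f = TensorProduct.map (C.parity ^ q) f ∘ₗ A.coact

/-- The differential `h ↦ d h + (-1)^p h d` of graded maps; it is used for `h` of degree `p - 1`. -/
def homD {A X : DGComodule.{u, v} C} (p : ℕ) (h : A.carrier →ₗ[k] X.carrier) :
    A.carrier →ₗ[k] X.carrier :=
  X.d ∘ₗ h + (-1 : k) ^ p • (h ∘ₗ A.d)

namespace IsGradedColinear

variable {A X : DGComodule.{u, v} C} {p : ℤ} {q : ℕ}

theorem zero : IsGradedColinear (A := A) (X := X) p q 0 :=
  ⟨fun _ _ _ => by simp, by simp⟩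

theorem add {f g : A.carrier →ₗ[k] X.carrier} (hf : IsGradedColinear p q f)
    (hg : IsGradedColinear p q g) : IsGradedColinear p q (f + g) :=
  ⟨fun n x hx => Submodule.add_mem _ (hf.map_mem n x hx) (hg.map_mem n x hx), by
    rw [LinearMap.comp_add, hf.colinear, hg.colinear, TensorProduct.map_add_right,
      LinearMap.add_comp]⟩

theorem smul {f : A.carrier →ₗ[k] X.carrier} (c : k) (hf : IsGradedColinear p q f) :
    IsGradedColinear p q (c • f) :=
  ⟨fun n x hx => Submodule.smul_mem _ _ (hf.map_mem n x hx), by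
    rw [LinearMap.comp_smul, hf.colinear, TensorProduct.map_smul_right, LinearMap.smul_comp]⟩

theorem sub {f g : A.carrier →ₗ[k] X.carrier} (hf : IsGradedColinear p q f)
    (hg : IsGradedColinear p q g) : IsGradedColinear p q (f - g) := by
  have := hf.add (hg.smul (-1))
  rwa [neg_one_smul, ← sub_eq_add_neg] at this

theorem sum {ι : Type*} (s : Finset ι) {f : ι → A.carrier →ₗ[k] X.carrier}
    (hf : ∀ i, IsGradedColinear p q (f i)) : IsGradedColinear p q (∑ i ∈ s, f i) := by
  classical
  induction s using Finset.induction_on with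
  | empty => simpa using zero
  | insert i s hi ih => rw [Finset.sum_insert hi]; exact (hf i).add ih

/-- A map of degree `p - 1` carries the sign exponent `p + 1`, which has the same parity but stays
in `ℕ` when `p = 0`. In the coaction of `homD p h`, the two terms that differentiate the factor in
`C` cancel, because `parity` anticommutes with `d`. -/
theorem homD {p : ℕ} {h : A.carrier →ₗ[k] X.carrier}
    (hh : IsGradedColinear ((p : ℤ) - 1) (p + 1) h) : IsGradedColinear p p (homD p h) := by
  refine ⟨fun n x hx => Submodule.add_mem _ ?_ (Submodule.smul_mem _ _ ?_), LinearMap.ext fun x => ?_⟩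
  · have := X.d_mem (hh.map_mem n x hx)
    rwa [show n + ((p : ℤ) - 1) + 1 = n + p by ring] at this
  · have := hh.map_mem _ _ (A.d_mem hx)
    rwa [show n + 1 + ((p : ℤ) - 1) = n + p by ring] at this
  · have h1 : ∀ y, X.coact (h y) = TensorProduct.map (C.parity ^ (p + 1)) h (A.coact y) :=
      LinearMap.congr_fun hh.colinear
    have h2 : X.coact (X.d (h x)) = tensorD C.toDGModule X.toDGModule (X.coact (h x)) :=
      LinearMap.congr_fun X.coact_comp_d (h x)
    have h3 : A.coact (A.d x) = tensorD C.toDGModule A.toDGModule (A.coact x) :=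
      LinearMap.congr_fun A.coact_comp_d x
    simp only [DGCo.homD, LinearMap.comp_apply, LinearMap.add_apply, LinearMap.smul_apply, map_add,
      map_smul, h2, h1, h3]
    generalize A.coact x = t
    induction t with
    | zero => simp
    | add x y hx hy =>
      simp only [map_add, smul_add] at hx hy ⊢
      rw [add_add_add_comm, hx, hy]
    | tmul c a =>
      have e1 := DGComodule.parity_pow_d C.toDGModule (p + 1) c
      have e2 : C.parity ((C.parity ^ (p + 1)) c) = (C.parity ^ p) c := by
        have : C.parity * C.parity = 1 := C.parity_comp_parity
        rw [pow_succ', ← Module.End.mul_apply, ← mul_assoc, this, one_mul]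
      have e3 : (C.parity ^ (p + 1)) (C.parity c) = (C.parity ^ p) c := by
        rw [← Module.End.mul_apply, ← pow_succ, pow_succ', Module.End.mul_apply, e2]
      simp only [tensorD, LinearMap.add_apply, TensorProduct.map_tmul, LinearMap.id_apply, map_add,
        e1, e2, e3, ← TensorProduct.smul_tmul', smul_add, smul_smul, TensorProduct.tmul_add,
        LinearMap.comp_apply, LinearMap.smul_apply, TensorProduct.tmul_smul]
      rw [pow_succ (-1 : k), ← mul_assoc, neg_one_pow_mul_self, one_mul, neg_one_smul]
      abel

end IsGradedColinear

/-- Boundaries are closed: this is `d² = 0` in the complex of graded maps, so subtracting a boundary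
keeps a map closed. -/
theorem homD_comp_d {A X : DGComodule.{u, v} C} (p : ℕ) (h : A.carrier →ₗ[k] X.carrier) :
    homD p h ∘ₗ A.d = (-1 : k) ^ p • (X.d ∘ₗ homD p h) := by
  refine LinearMap.ext fun x => ?_
  have h1 : A.d (A.d x) = 0 := LinearMap.congr_fun A.d_comp_d x
  have h2 : X.d (X.d (h x)) = 0 := LinearMap.congr_fun X.d_comp_d (h x)
  simp [homD, h1, h2, smul_smul, neg_one_pow_mul_self]

theorem homD_add {A X : DGComodule.{u, v} C} (p : ℕ) (h h' : A.carrier →ₗ[k] X.carrier) :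
    homD p (h + h') = homD p h + homD p h' := by
  simp only [homD, LinearMap.comp_add, LinearMap.add_comp, smul_add]; abel

/-! ### Successive approximation along a filtration. -/

/-- A map that can be made to vanish to any order along a filtration which is separated in each
degree, by subtracting boundaries of increasing order, is a boundary. -/
theorem exists_homD_eq {A X : DGComodule.{u, v} C} (p : ℕ) (F : ℕ → Submodule k X.carrier)
    (hF₀ : F 0 = ⊤) (hF : ∀ n : ℤ, ∃ J : ℕ, ∀ j ≥ J, ∀ x ∈ F j, x ∈ X.deg n → x = 0)
    (hstep : ∀ (j : ℕ) (f : A.carrier →ₗ[k] X.carrier), IsGradedColinear p p f →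
      f ∘ₗ A.d = (-1 : k) ^ p • (X.d ∘ₗ f) → (∀ x, f x ∈ F j) →
      ∃ h : A.carrier →ₗ[k] X.carrier, IsGradedColinear ((p : ℤ) - 1) (p + 1) h ∧
        (∀ x, h x ∈ F j) ∧ ∀ x, (f - homD p h) x ∈ F (j + 1))
    (f : A.carrier →ₗ[k] X.carrier) (hf : IsGradedColinear p p f)
    (hfd : f ∘ₗ A.d = (-1 : k) ^ p • (X.d ∘ₗ f)) :
    ∃ h : A.carrier →ₗ[k] X.carrier, IsGradedColinear ((p : ℤ) - 1) (p + 1) h ∧ f = homD p h := by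
  classical
  -- The state after `j` corrections: a closed colinear map with values in `F j`. The recursion `φ`
  -- subtracts the boundary supplied by `hstep` at each stage.
  let S (j : ℕ) := {f : A.carrier →ₗ[k] X.carrier // IsGradedColinear p p f ∧
    f ∘ₗ A.d = (-1 : k) ^ p • (X.d ∘ₗ f) ∧ ∀ x, f x ∈ F j}
  choose H hH₁ hH₂ hH₃ using hstep
  let next (j : ℕ) (f : S j) : S (j + 1) :=
    ⟨f.1 - homD p (H j f.1 f.2.1 f.2.2.1 f.2.2.2), f.2.1.sub (hH₁ ..).homD, by
      rw [LinearMap.sub_comp, LinearMap.comp_sub, smul_sub, homD_comp_d]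
      exact congrArg (· - _) f.2.2.1, fun x => hH₃ ..⟩
  let φ : ∀ j, S j := fun j => Nat.rec ⟨f, hf, hfd, fun x => hF₀ ▸ Submodule.mem_top⟩ next j
  let h (j : ℕ) : A.carrier →ₗ[k] X.carrier := H j (φ j).1 (φ j).2.1 (φ j).2.2.1 (φ j).2.2.2
  have hφ : ∀ j, (φ (j + 1)).1 = (φ j).1 - homD p (h j) := fun j => rfl
  have hh : ∀ j, IsGradedColinear ((p : ℤ) - 1) (p + 1) (h j) := fun j => hH₁ ..
  have hhF : ∀ j x, h j x ∈ F j := fun j x => hH₂ ..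
  let s (J : ℕ) : A.carrier →ₗ[k] X.carrier := ∑ j ∈ Finset.range J, h j
  have hs : ∀ J, (φ J).1 = f - homD p (s J) := by
    intro J
    induction J with
    | zero => simp [s, homD, φ]
    | succ J ih =>
      rw [hφ, ih, show s (J + 1) = s J + h J from Finset.sum_range_succ _ _, homD_add]
      abel
  -- The bound from `hF` depends on the degree, so it is used on homogeneous elements and then
  -- extended to finite sums of them.
  have vanish : ∀ (r : ℤ) (g : ℕ → A.carrier →ₗ[k] X.carrier), (∀ j x, g j x ∈ F j) →
      (∀ j n x, x ∈ A.deg n → g j x ∈ X.deg (n + r)) → ∀ x, ∃ J, ∀ j ≥ J, g j x = 0 := by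
    intro r g hgF hg x
    have hx : x ∈ ⨆ n, A.deg n := A.isInternal.submodule_iSup_eq_top ▸ Submodule.mem_top
    induction hx using Submodule.iSup_induction' with
    | mem n x hx =>
      obtain ⟨J, hJ⟩ := hF (n + r)
      exact ⟨J, fun j hj => hJ j hj _ (hgF j x) (hg j n x hx)⟩
    | zero => exact ⟨0, fun j _ => map_zero _⟩
    | add x y _ _ hx hy =>
      obtain ⟨J, hJ⟩ := hx
      obtain ⟨J', hJ'⟩ := hy
      exact ⟨max J J', fun j hj => by
        rw [map_add, hJ j (le_of_max_le_left hj), hJ' j (le_of_max_le_right hj), add_zero]⟩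
  have hh0 := vanish _ h hhF fun j => (hh j).map_mem
  have hφ0 := vanish _ (fun j => (φ j).1) (fun j => (φ j).2.2.2) fun j => (φ j).2.1.map_mem
  have hfin : ∀ x, (Function.support fun j => h j x).Finite := fun x => by
    obtain ⟨J, hJ⟩ := hh0 x
    refine (Finset.finite_toSet (Finset.range J)).subset fun j hj => ?_
    by_contra hj'
    exact hj (hJ j (by simpa using hj'))
  -- The sum of all corrections, finite at each element. By `hlim` it agrees there with all
  -- sufficiently long partial sums `s J`, from which it inherits its properties.
  let h' : A.carrier →ₗ[k] X.carrier :=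
    { toFun := fun x => ∑ᶠ j, h j x
      map_add' := fun x y => by
        simp only [map_add]
        exact finsum_add_distrib (hfin x) (hfin y)
      map_smul' := fun c x => by
        simp only [map_smul, RingHom.id_apply]
        exact (smul_finsum' c (hfin x)).symm }
  have hlim : ∀ x, ∃ J, ∀ J' ≥ J, h' x = s J' x := fun x => by
    obtain ⟨J, hJ⟩ := hh0 x
    refine ⟨J, fun J' hJ' => ?_⟩
    change ∑ᶠ j, h j x = _
    rw [LinearMap.sum_apply]
    refine finsum_eq_sum_of_support_subset _ fun j hj => ?_
    by_contra hj'
    exact hj (hJ j (hJ'.trans (by simpa using hj')))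
  have hsC : ∀ J, IsGradedColinear ((p : ℤ) - 1) (p + 1) (s J) := fun J =>
    IsGradedColinear.sum _ hh
  refine ⟨h', ⟨fun n x hx => ?_, LinearMap.ext fun x => ?_⟩, LinearMap.ext fun x => ?_⟩
  · obtain ⟨J, hJ⟩ := hlim x
    rw [hJ J le_rfl]
    exact (hsC J).map_mem n x hx
  -- A tensor involves only finitely many elements of `A`, so one partial sum also computes `h'` on
  -- all of `A.coact x`.
  · have hlim₂ : ∀ t : C.carrier ⊗[k] A.carrier, ∃ J, ∀ J' ≥ J,
        TensorProduct.map (C.parity ^ (p + 1)) h' t =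
          TensorProduct.map (C.parity ^ (p + 1)) (s J') t := by
      intro t
      induction t with
      | zero => exact ⟨0, fun _ _ => by simp⟩
      | add x y hx hy =>
        obtain ⟨J, hJ⟩ := hx
        obtain ⟨J', hJ'⟩ := hy
        exact ⟨max J J', fun j hj => by
          rw [map_add, map_add, hJ j (le_of_max_le_left hj), hJ' j (le_of_max_le_right hj)]⟩
      | tmul c a =>
        obtain ⟨J, hJ⟩ := hlim a
        exact ⟨J, fun j hj => by rw [TensorProduct.map_tmul, TensorProduct.map_tmul, hJ j hj]⟩
    obtain ⟨J, hJ⟩ := hlim x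
    obtain ⟨J', hJ'⟩ := hlim₂ (A.coact x)
    rw [LinearMap.comp_apply, LinearMap.comp_apply, hJ _ (le_max_left J J'),
      hJ' _ (le_max_right J J')]
    exact LinearMap.congr_fun (hsC _).colinear x
  · obtain ⟨J₁, hJ₁⟩ := hlim x
    obtain ⟨J₂, hJ₂⟩ := hlim (A.d x)
    obtain ⟨J₃, hJ₃⟩ := hφ0 x
    -- Far enough out, `s J` agrees with `h'` at both `x` and `d x`, and the remainder `f - homD p
    -- (s J)` vanishes at `x`.
    let J := max J₁ (max J₂ J₃)
    have h1 := hJ₁ J (le_max_left _ _)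
    have h2 := hJ₂ J ((le_max_left _ _).trans (le_max_right _ _))
    have h3 := hJ₃ J ((le_max_right _ _).trans (le_max_right _ _))
    rw [hs J, LinearMap.sub_apply, sub_eq_zero] at h3
    rw [h3]
    simp only [homD, LinearMap.add_apply, LinearMap.comp_apply, LinearMap.smul_apply, h1, h2]

/-! ### Counit identities on `C ⊗ W`. -/

namespace DGCoalgebra

variable (C)

/-- `ε ⊗ id : C ⊗ W → W`. -/
def counitTensor (W : Type v) [AddCommGroup W] [Module k W] : C.carrier ⊗[k] W →ₗ[k] W :=
  (TensorProduct.lid k W).toLinearMap ∘ₗ TensorProduct.map Coalgebra.counit LinearMap.id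

theorem counitTensor_tmul {W : Type v} [AddCommGroup W] [Module k W] (c : C.carrier) (w : W) :
    C.counitTensor W (c ⊗ₜ[k] w) = Coalgebra.counit (R := k) c • w := by
  simp [counitTensor]

theorem counitTensor_naturality {W W' : Type v} [AddCommGroup W] [Module k W] [AddCommGroup W']
    [Module k W'] (f : W →ₗ[k] W') (x : C.carrier ⊗[k] W) :
    C.counitTensor W' (TensorProduct.map LinearMap.id f x) = f (C.counitTensor W x) := by
  induction x with
  | zero => simp
  | add x y hx hy => simp only [map_add, hx, hy]
  | tmul c w => simp [counitTensor_tmul]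

theorem counitTensor_tensorD (W : DGModule.{u, v} k) (x : C.carrier ⊗[k] W.carrier) :
    C.counitTensor W.carrier (tensorD C.toDGModule W x) = W.d (C.counitTensor W.carrier x) := by
  induction x with
  | zero => simp
  | add x y hx hy => simp only [map_add, hx, hy]
  | tmul c w =>
    have h1 : Coalgebra.counit (R := k) (C.d c) = 0 := LinearMap.congr_fun C.counit_comp_d c
    have h2 : Coalgebra.counit (R := k) (C.parity c) = Coalgebra.counit (R := k) c :=
      LinearMap.congr_fun C.counit_comp_parity c
    simp [tensorD, counitTensor_tmul, h1, h2]

theorem counitTensor_mem (W : DGModule.{u, v} k) {n : ℤ} {x : C.carrier ⊗[k] W.carrier}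
    (hx : x ∈ tensorDeg C.toDGModule W n) : C.counitTensor W.carrier x ∈ W.deg n := by
  have : tensorDeg C.toDGModule W n ≤ (W.deg n).comap (C.counitTensor W.carrier) := by
    refine tensorDeg_le _ _ fun p q h x hx y hy => ?_
    rw [Submodule.mem_comap, counitTensor_tmul]
    by_cases hp : p = 0
    · obtain rfl : q = n := by omega
      exact Submodule.smul_mem _ _ hy
    · rw [C.counit_of_mem hx hp, zero_smul]
      exact Submodule.zero_mem _
  exact this hx

/-- The right counit law. It is what makes `C ⊗ W` cofree: a colinear map into it can be recovered
from its composite with `ε ⊗ id`. -/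
theorem map_counitTensor_comulTensor (W : Type v) [AddCommGroup W] [Module k W]
    (x : C.carrier ⊗[k] W) :
    TensorProduct.map LinearMap.id (C.counitTensor W) (C.comulTensor W x) = x := by
  induction x with
  | zero => simp
  | add x y hx hy => simp only [map_add, hx, hy]
  | tmul c w =>
    have h : ∀ t : C.carrier ⊗[k] C.carrier,
        TensorProduct.map LinearMap.id (C.counitTensor W) (TensorProduct.assoc k _ _ _ (t ⊗ₜ[k] w)) =
          TensorProduct.rid k _ (LinearMap.lTensor _ Coalgebra.counit t) ⊗ₜ[k] w := by
      intro t
      induction t with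
      | zero => simp
      | add x y hx hy => simp only [TensorProduct.add_tmul, map_add, hx, hy]
      | tmul a b => simp [counitTensor_tmul, TensorProduct.smul_tmul]
    refine (h _).trans ?_
    rw [Coalgebra.lTensor_counit_comul, TensorProduct.rid_tmul, one_smul]

/-- The left counit law, which drives the contraction of the standard resolution. -/
theorem counitTensor_comulTensor (W : Type v) [AddCommGroup W] [Module k W]
    (x : C.carrier ⊗[k] W) : C.counitTensor _ (C.comulTensor W x) = x := by
  induction x with
  | zero => simp
  | add x y hx hy => simp only [map_add, hx, hy]
  | tmul c w =>
    have h : ∀ t : C.carrier ⊗[k] C.carrier,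
        C.counitTensor _ (TensorProduct.assoc k _ _ _ (t ⊗ₜ[k] w)) =
          TensorProduct.lid k _ (LinearMap.rTensor _ Coalgebra.counit t) ⊗ₜ[k] w := by
      intro t
      induction t with
      | zero => simp
      | add x y hx hy => simp only [TensorProduct.add_tmul, map_add, hx, hy]
      | tmul a b => simp [counitTensor_tmul, TensorProduct.smul_tmul']
    refine (h _).trans ?_
    rw [Coalgebra.rTensor_counit_comul, TensorProduct.lid_tmul, one_smul]

theorem comulTensor_map_parity_pow {W W' : Type v} [AddCommGroup W] [Module k W] [AddCommGroup W']
    [Module k W'] (q : ℕ) (f : W →ₗ[k] W') (x : C.carrier ⊗[k] W) :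
    C.comulTensor W' (TensorProduct.map (C.parity ^ q) f x) =
      TensorProduct.map (C.parity ^ q) (TensorProduct.map (C.parity ^ q) f)
        (C.comulTensor W x) := by
  induction x with
  | zero => simp
  | add x y hx hy => simp only [map_add, hx, hy]
  | tmul a b =>
    simp only [comulTensor, LinearMap.comp_apply, TensorProduct.map_tmul, LinearMap.id_apply,
      LinearEquiv.coe_coe, DGComodule.comul_parity_pow]
    generalize (Coalgebra.comul (R := k) a) = t
    induction t with
    | zero => simp
    | add x y hx hy => simp only [TensorProduct.add_tmul, map_add, hx, hy]
    | tmul x y => simp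

theorem tensorDeg_eq_bot {C : DGCoalgebra.{u, v} k} (hC : C.PositivelyGraded)
    {W : DGModule.{u, v} k} {n₀ : ℤ} (hW : ∀ n < n₀, W.deg n = ⊥) :
    ∀ n < n₀, tensorDeg C.toDGModule W n = ⊥ := fun n hn => by
  refine eq_bot_iff.2 (tensorDeg_le _ _ fun p q h x hx y hy => ?_)
  rcases lt_or_ge p 0 with hp | hp
  · rw [hC p hp, Submodule.mem_bot] at hx
    simp [hx]
  · rw [hW q (by omega), Submodule.mem_bot] at hy
    simp [hy]

end DGCoalgebra

/-! ### The filtration of the standard resolution by tensor length. -/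

namespace DGComodule

variable (M : DGComodule.{u, v} C)

/-- The projection to the summand `C^{⊗ (n + 1)} ⊗ M`. -/
abbrev proj (n : ℕ) : (⨁ n, M.summand n) →ₗ[k] M.summand n :=
  DirectSum.component k ℕ (fun n => M.summand n) n

theorem proj_incl_self (n : ℕ) (x : M.summand n) : M.proj n (M.incl n x) = x :=
  DirectSum.component.lof_self k (M := fun n => (M.summand n).carrier) n x

theorem proj_incl_of_ne {m n : ℕ} (h : m ≠ n) (x : M.summand m) : M.proj n (M.incl m x) = 0 := by
  rw [proj, incl, DirectSum.component.of, dif_neg h]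

theorem proj_zero_d (x : ⨁ n, M.summand n) :
    M.proj 0 (M.cobarComplex.d x) = (M.summand 0).d (M.proj 0 x) := by
  have : M.proj 0 ∘ₗ M.cobarComplex.d = (M.summand 0).d ∘ₗ M.proj 0 := by
    refine DirectSum.linearMap_ext _ fun n => LinearMap.ext fun x => ?_
    change M.proj 0 (M.cobarComplex.d (M.incl n x)) = (M.summand 0).d (M.proj 0 (M.incl n x))
    rw [cobarComplex_d_incl, map_add, map_smul, proj_incl_of_ne M (Nat.succ_ne_zero n), add_zero]
    rcases Nat.eq_zero_or_pos n with rfl | hn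
    · rw [proj_incl_self, proj_incl_self, pow_zero, one_smul]
    · rw [proj_incl_of_ne M hn.ne', proj_incl_of_ne M hn.ne', smul_zero, map_zero]
  exact LinearMap.congr_fun this x

theorem proj_succ_d (j : ℕ) (x : ⨁ n, M.summand n) :
    M.proj (j + 1) (M.cobarComplex.d x) =
      (-1 : k) ^ (j + 1) • (M.summand (j + 1)).d (M.proj (j + 1) x) + M.bPrime j (M.proj j x) := by
  have : M.proj (j + 1) ∘ₗ M.cobarComplex.d =
      (-1 : k) ^ (j + 1) • ((M.summand (j + 1)).d ∘ₗ M.proj (j + 1)) + M.bPrime j ∘ₗ M.proj j := by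
    refine DirectSum.linearMap_ext _ fun n => LinearMap.ext fun x => ?_
    change M.proj (j + 1) (M.cobarComplex.d (M.incl n x)) =
      (-1 : k) ^ (j + 1) • (M.summand (j + 1)).d (M.proj (j + 1) (M.incl n x)) +
        M.bPrime j (M.proj j (M.incl n x))
    rw [cobarComplex_d_incl, map_add, map_smul]
    by_cases h1 : n = j
    · subst h1
      rw [proj_incl_self, proj_incl_self, proj_incl_of_ne M (Nat.lt_succ_self n).ne,
        proj_incl_of_ne M (Nat.lt_succ_self n).ne, map_zero, smul_zero, smul_zero]
    · rw [proj_incl_of_ne M h1, proj_incl_of_ne M (m := n + 1) (n := j + 1) (by omega), map_zero,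
        add_zero, add_zero]
      by_cases h2 : n = j + 1
      · subst h2
        rw [proj_incl_self, proj_incl_self]
      · rw [proj_incl_of_ne M h2, proj_incl_of_ne M h2, map_zero, smul_zero, smul_zero]
  exact LinearMap.congr_fun this x

/-- The subspace `⨁_{n ≥ j} C^{⊗ (n + 1)} ⊗ M` of the standard resolution. -/
def cobarFilt (j : ℕ) : Submodule k (⨁ n, M.summand n) :=
  ⨅ n : Fin j, LinearMap.ker (M.proj n)

theorem mem_cobarFilt {j : ℕ} {x : ⨁ n, M.summand n} :
    x ∈ M.cobarFilt j ↔ ∀ n < j, M.proj n x = 0 := by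
  simp only [cobarFilt, Submodule.mem_iInf, LinearMap.mem_ker]
  exact ⟨fun h n hn => h ⟨n, hn⟩, fun h n => h n n.2⟩

theorem incl_mem_cobarFilt (j : ℕ) (x : M.summand j) : M.incl j x ∈ M.cobarFilt j :=
  M.mem_cobarFilt.2 fun _ hn => M.proj_incl_of_ne hn.ne' x

theorem d_mem_cobarFilt {j : ℕ} {x : ⨁ n, M.summand n} (hx : x ∈ M.cobarFilt j) :
    M.cobarComplex.d x ∈ M.cobarFilt j := by
  rw [mem_cobarFilt] at hx ⊢
  rintro (_ | n) hn
  · rw [proj_zero_d, hx 0 hn, map_zero]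
  · rw [proj_succ_d, hx _ hn, hx n (by omega), map_zero, map_zero, smul_zero, add_zero]

/-- The map `b'` raises tensor length, so on the leading component only the internal differential
acts. -/
theorem proj_d_of_mem_cobarFilt {j : ℕ} {x : ⨁ n, M.summand n} (hx : x ∈ M.cobarFilt j) :
    M.proj j (M.cobarComplex.d x) = (-1 : k) ^ j • (M.summand j).d (M.proj j x) := by
  rw [mem_cobarFilt] at hx
  cases j with
  | zero => rw [proj_zero_d, pow_zero, one_smul]
  | succ n => rw [proj_succ_d, hx n (by omega), map_zero, add_zero]

theorem map_proj_cobarCoact (j : ℕ) (x : ⨁ n, M.summand n) :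
    TensorProduct.map LinearMap.id (M.proj j) (M.cobarCoact x) =
      TensorProduct.map (C.parity ^ j) LinearMap.id
        (C.comulTensor (M.power j).carrier (M.proj j x)) := by
  have : TensorProduct.map LinearMap.id (M.proj j) ∘ₗ M.cobarCoact =
      TensorProduct.map (C.parity ^ j) LinearMap.id ∘ₗ
        C.comulTensor (M.power j).carrier ∘ₗ M.proj j := by
    refine DirectSum.linearMap_ext _ fun n => LinearMap.ext fun x => ?_
    change TensorProduct.map LinearMap.id (M.proj j) (M.cobarCoact (M.incl n x)) =
      TensorProduct.map (C.parity ^ j) LinearMap.id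
        (C.comulTensor (M.power j).carrier (M.proj j (M.incl n x)))
    rw [cobarCoact_incl, ← LinearMap.comp_apply, ← TensorProduct.map_comp, LinearMap.id_comp]
    by_cases h : n = j
    · subst h
      rw [proj_incl_self]
      have : M.proj n ∘ₗ M.incl n = LinearMap.id := LinearMap.ext fun y => M.proj_incl_self n y
      rw [this]
    · rw [proj_incl_of_ne M h]
      have : M.proj j ∘ₗ M.incl n = 0 := LinearMap.ext fun y => M.proj_incl_of_ne h y
      rw [this, TensorProduct.map_zero_right, map_zero, map_zero]
      rfl
  exact LinearMap.congr_fun this x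

theorem proj_mem {p : ℤ} {x : ⨁ n, M.summand n} (hx : x ∈ totalDeg M.summand p) (j : ℕ) :
    M.proj j x ∈ (M.summand j).deg (p - j) := by
  have : totalDeg M.summand p ≤ ((M.summand j).deg (p - j)).comap (M.proj j) := by
    refine totalDeg_le _ fun n q h x hx => ?_
    rw [Submodule.mem_comap]
    by_cases hn : n = j
    · subst hn
      obtain rfl : q = p - n := by omega
      exact (M.proj_incl_self n x).symm ▸ hx
    · exact (M.proj_incl_of_ne hn x).symm ▸ Submodule.zero_mem _
  exact this hx

/-! ### Cofreeness of the summands and the correction step. -/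

section Cofree

variable {M} {A : DGComodule.{u, v} C}

/-- The graded colinear map with values in the cofree summand `C ⊗ (C^{⊗ j} ⊗ M)` that corresponds
to a linear map `u : A → C^{⊗ j} ⊗ M`. -/
def cofreeLift (j q : ℕ) (u : A.carrier →ₗ[k] (M.power j).carrier) :
    A.carrier →ₗ[k] M.summand j :=
  TensorProduct.map (C.parity ^ q) u ∘ₗ A.coact

/-- Coassociativity of `A` makes the lift colinear. The coaction on the summand of index `j`
contributes the additional sign `parity ^ j`, so the total exponent is `j + q`. -/
theorem cofreeLift_colinear (j q : ℕ) (u : A.carrier →ₗ[k] (M.power j).carrier) :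
    M.cobarCoact ∘ₗ M.incl j ∘ₗ cofreeLift j q u =
      TensorProduct.map (C.parity ^ (j + q)) (M.incl j ∘ₗ cofreeLift j q u) ∘ₗ A.coact := by
  refine LinearMap.ext fun x => ?_
  have h1 : C.comulTensor A.carrier (A.coact x) =
      TensorProduct.map LinearMap.id A.coact (A.coact x) := LinearMap.congr_fun A.coassoc x
  rw [LinearMap.comp_apply, LinearMap.comp_apply, cobarCoact_incl]
  have h2 := C.comulTensor_map_parity_pow q u (A.coact x)
  rw [h1] at h2
  refine (congrArg _ h2).trans ?_
  rw [LinearMap.comp_apply]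
  generalize A.coact x = t
  induction t with
  | zero => simp
  | add x y hx hy => simp only [map_add, hx, hy]
  | tmul c a =>
    simp only [TensorProduct.map_tmul, LinearMap.id_apply, pow_add, Module.End.mul_apply]
    rfl

theorem cofreeLift_mem (j q : ℕ) {u : A.carrier →ₗ[k] (M.power j).carrier} {p : ℤ}
    (hu : ∀ n, ∀ x ∈ A.deg n, u x ∈ (M.power j).deg (n + p)) {n : ℤ} {x : A.carrier}
    (hx : x ∈ A.deg n) : cofreeLift j q u x ∈ (M.summand j).deg (n + p) :=
  map_mem_tensorDeg (a := 0) (b := p) (W' := (M.power j).toDGModule)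
    (fun m x hx => by simpa using parity_pow_mem C.toDGModule q hx) hu (by omega)
    (A.coact_mem hx)

/-- A graded colinear map is determined by its corestriction. -/
theorem cofreeLift_counitTensor {q : ℕ} {f : A.carrier →ₗ[k] ⨁ n, M.summand n}
    (hf : M.cobarCoact ∘ₗ f = TensorProduct.map (C.parity ^ q) f ∘ₗ A.coact) (j : ℕ) :
    cofreeLift j (j + q) (C.counitTensor (M.power j).carrier ∘ₗ M.proj j ∘ₗ f) =
      M.proj j ∘ₗ f := by
  refine LinearMap.ext fun x => ?_
  have h1 : M.cobarCoact (f x) = TensorProduct.map (C.parity ^ q) f (A.coact x) :=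
    LinearMap.congr_fun hf x
  have h2 := M.map_proj_cobarCoact j (f x)
  have h3 := C.map_counitTensor_comulTensor _ (M.proj j (f x))
  rw [h1] at h2
  -- The factor `parity ^ j` undoes the sign in the coaction of the summand, since its square is the
  -- identity; the counit law then leaves `M.proj j (f x)`.
  have h4 := congrArg (TensorProduct.map (C.parity ^ j) (C.counitTensor (M.power j).carrier)) h2
  have h5 : (C.parity ^ j) ∘ₗ (C.parity ^ j) = LinearMap.id := C.parity_pow_mul_self j
  simp only [TensorProduct.map_map, h5, LinearMap.id_comp, LinearMap.comp_id] at h4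
  rw [h3] at h4
  rw [cofreeLift, pow_add]
  exact h4

/-- Cofreeness is compatible with the differentials: the terms differentiating the factor in `C`
cancel, and what remains is the lift of the boundary of `u`. The factor `(-1) ^ j` is the sign of
the internal differential on the summand of index `j`. -/
theorem d_cofreeLift (j p : ℕ) (u : A.carrier →ₗ[k] (M.power j).carrier) (x : A.carrier) :
    (-1 : k) ^ j • (M.summand j).d (cofreeLift j (j + p + 1) u x) +
        (-1 : k) ^ p • cofreeLift j (j + p + 1) u (A.d x) =
      cofreeLift j (j + p) ((-1 : k) ^ j • ((M.power j).d ∘ₗ u) + (-1 : k) ^ p • (u ∘ₗ A.d)) x := by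
  have h3 : A.coact (A.d x) = tensorD C.toDGModule A.toDGModule (A.coact x) :=
    LinearMap.congr_fun A.coact_comp_d x
  simp only [cofreeLift, LinearMap.comp_apply, h3]
  generalize A.coact x = t
  induction t with
  | zero => simp
  | add x y hx hy =>
    simp only [map_add, smul_add] at hx hy ⊢
    rw [add_add_add_comm, hx, hy]
  | tmul c a =>
    have e1 := DGComodule.parity_pow_d C.toDGModule (j + p + 1) c
    have e2 : C.parity ((C.parity ^ (j + p + 1)) c) = (C.parity ^ (j + p)) c := by
      have : C.parity * C.parity = 1 := C.parity_comp_parity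
      rw [pow_succ', ← Module.End.mul_apply, ← mul_assoc, this, one_mul]
    have e3 : (C.parity ^ (j + p + 1)) (C.parity c) = (C.parity ^ (j + p)) c := by
      rw [← Module.End.mul_apply, ← pow_succ, pow_succ', Module.End.mul_apply, e2]
    have e4 : (-1 : k) ^ p * (-1 : k) ^ (j + p + 1) = -(-1 : k) ^ j := by
      rw [pow_succ, pow_add, mul_comm ((-1 : k) ^ j), ← mul_assoc, ← mul_assoc,
        neg_one_pow_mul_self, one_mul, mul_neg_one]
    simp only [tensorD, LinearMap.add_apply, TensorProduct.map_tmul, LinearMap.id_apply, map_add,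
      e1, e2, e3, ← TensorProduct.smul_tmul', smul_add, smul_smul, TensorProduct.tmul_add,
      LinearMap.comp_apply, LinearMap.smul_apply, TensorProduct.tmul_smul, e4, neg_smul]
    abel

/-- If a closed graded colinear map `f` from a contractible comodule vanishes to order `j`, then it
vanishes to order `j + 1` up to a boundary. -/
theorem exists_cofreeLift_sub_mem {s : A.carrier →ₗ[k] A.carrier}
    (hs : ∀ n, ∀ x ∈ A.deg n, s x ∈ A.deg (n - 1)) (hds : A.d ∘ₗ s + s ∘ₗ A.d = LinearMap.id)
    (p j : ℕ) {f : A.carrier →ₗ[k] ⨁ n, M.summand n}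
    (hf : ∀ n, ∀ x ∈ A.deg n, f x ∈ totalDeg M.summand (n + p))
    (hfc : M.cobarCoact ∘ₗ f = TensorProduct.map (C.parity ^ p) f ∘ₗ A.coact)
    (hfd : f ∘ₗ A.d = (-1 : k) ^ p • (M.cobarComplex.d ∘ₗ f)) (hfF : ∀ x, f x ∈ M.cobarFilt j) :
    ∃ u : A.carrier →ₗ[k] (M.power j).carrier,
      (∀ n, ∀ x ∈ A.deg n, u x ∈ (M.power j).deg (n + (p - 1 - j))) ∧
      ∀ x, f x - (M.cobarComplex.d (M.incl j (cofreeLift j (j + p + 1) u x)) +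
        (-1 : k) ^ p • M.incl j (cofreeLift j (j + p + 1) u (A.d x))) ∈ M.cobarFilt (j + 1) := by
  -- The corestriction of the leading component of `f`. It is a closed linear map because `f` is
  -- closed and takes values in `cobarFilt j`.
  let g : A.carrier →ₗ[k] (M.power j).carrier :=
    C.counitTensor (M.power j).carrier ∘ₗ M.proj j ∘ₗ f
  have hg : ∀ x, g (A.d x) = (-1 : k) ^ p • (-1 : k) ^ j • (M.power j).d (g x) := fun x => by
    have h1 : f (A.d x) = (-1 : k) ^ p • M.cobarComplex.d (f x) := LinearMap.congr_fun hfd x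
    change C.counitTensor (M.power j).carrier (M.proj j (f (A.d x))) = _
    rw [h1, map_smul, map_smul, proj_d_of_mem_cobarFilt M (hfF x), map_smul]
    exact congrArg (fun y => (-1 : k) ^ p • (-1 : k) ^ j • y) (C.counitTensor_tensorD _ _)
  -- Closedness of `g` turns the first term into `g d s`, and the signs of the second cancel to give
  -- `g s d`; their sum is `g` by the contraction identity.
  have hu : (-1 : k) ^ j • ((M.power j).d ∘ₗ ((-1 : k) ^ p • (g ∘ₗ s))) +
      (-1 : k) ^ p • (((-1 : k) ^ p • (g ∘ₗ s)) ∘ₗ A.d) = g := by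
    refine LinearMap.ext fun x => ?_
    have h1 : A.d (s x) + s (A.d x) = x := LinearMap.congr_fun hds x
    have h2 := hg (s x)
    simp only [LinearMap.add_apply, LinearMap.smul_apply, LinearMap.comp_apply, map_smul]
    rw [smul_comm, ← h2, smul_smul, neg_one_pow_mul_self, one_smul, ← map_add, h1]
  refine ⟨(-1 : k) ^ p • (g ∘ₗ s), fun n x hx => ?_, fun x => ?_⟩
  · refine Submodule.smul_mem _ _ (C.counitTensor_mem _ ?_)
    have := M.proj_mem (hf _ _ (hs n x hx)) j
    rwa [show n - 1 + (p : ℤ) - j = n + (p - 1 - j) by ring] at this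
  · have h1 := d_cofreeLift j p ((-1 : k) ^ p • (g ∘ₗ s)) x
    rw [hu, LinearMap.congr_fun (cofreeLift_counitTensor hfc j) x, LinearMap.comp_apply] at h1
    -- The correction lies in `cobarFilt j`, so the components below `j` stay zero; component `j` is
    -- then killed by `h1`.
    have hF : f x - (M.cobarComplex.d (M.incl j (cofreeLift j (j + p + 1) ((-1 : k) ^ p • (g ∘ₗ s)) x)) +
        (-1 : k) ^ p • M.incl j (cofreeLift j (j + p + 1) ((-1 : k) ^ p • (g ∘ₗ s)) (A.d x))) ∈
        M.cobarFilt j :=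
      Submodule.sub_mem _ (hfF x) (Submodule.add_mem _
        (M.d_mem_cobarFilt (M.incl_mem_cobarFilt j _))
        (Submodule.smul_mem _ _ (M.incl_mem_cobarFilt j _)))
    rw [mem_cobarFilt] at hF ⊢
    intro n hn
    rcases Nat.lt_succ_iff_lt_or_eq.1 hn with hn | rfl
    · exact hF n hn
    · rw [map_sub, map_add, map_smul, proj_d_of_mem_cobarFilt M (M.incl_mem_cobarFilt n _),
        proj_incl_self, proj_incl_self, h1, sub_self]

end Cofree

/-! ### Boundedness, and closed maps from acyclic comodules. -/

theorem power_deg_eq_bot (hC : C.PositivelyGraded) {n₀ : ℤ} (hM : ∀ n < n₀, M.deg n = ⊥) (j : ℕ) :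
    ∀ n < n₀, (M.power j).deg n = ⊥ := by
  induction j with
  | zero => exact hM
  | succ j ih => exact fun n hn => DGCoalgebra.tensorDeg_eq_bot hC ih n hn

theorem summand_deg_eq_bot (hC : C.PositivelyGraded) {n₀ : ℤ} (hM : ∀ n < n₀, M.deg n = ⊥) (j : ℕ) :
    ∀ n < n₀, (M.summand j).deg n = ⊥ :=
  DGCoalgebra.tensorDeg_eq_bot hC (M.power_deg_eq_bot hC hM j)

theorem cobar_leftBounded (hC : C.PositivelyGraded) (hM : M.LeftBounded) :
    M.cobar.LeftBounded := by
  obtain ⟨n₀, hM⟩ := hM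
  refine ⟨n₀, fun p hp => eq_bot_iff.2 (totalDeg_le _ fun n q h x hx => ?_)⟩
  rw [M.summand_deg_eq_bot hC hM n q (by omega), Submodule.mem_bot] at hx
  rw [hx, map_zero]
  exact Submodule.zero_mem _

/-- Tensoring with the positively graded `C` does not lower the bound `n₀`, and the shift raises it
by `n` on the summand of index `n`. Hence `cobarFilt j` starts in degree `n₀ + j`, which is the
separatedness required by `exists_homD_eq`. -/
theorem eq_zero_of_mem_cobarFilt (hC : C.PositivelyGraded) {n₀ : ℤ} (hM : ∀ n < n₀, M.deg n = ⊥)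
    {p : ℤ} {j : ℕ} (hj : p - j < n₀) {x : ⨁ n, M.summand n} (hx : x ∈ M.cobarFilt j)
    (hxp : x ∈ totalDeg M.summand p) : x = 0 := by
  refine DirectSum.ext_component k fun n => ?_
  rw [map_zero]
  rcases lt_or_ge n j with hn | hn
  · exact M.mem_cobarFilt.1 hx n hn
  · have := M.proj_mem hxp n
    rwa [M.summand_deg_eq_bot hC hM n _ (by omega), Submodule.mem_bot] at this

/-- Closed graded colinear maps from an acyclic comodule to the standard resolution of a left
bounded comodule are boundaries. -/
theorem exists_homD_eq_of_acyclic (hC : C.PositivelyGraded) (hM : M.LeftBounded)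
    {A : DGComodule.{u, v} C} (hA : LinearMap.ker A.d ≤ LinearMap.range A.d) (p : ℕ)
    (f : A.carrier →ₗ[k] M.cobar.carrier) (hf : IsGradedColinear p p f)
    (hfd : f ∘ₗ A.d = (-1 : k) ^ p • (M.cobar.d ∘ₗ f)) :
    ∃ h : A.carrier →ₗ[k] M.cobar.carrier,
      IsGradedColinear ((p : ℤ) - 1) (p + 1) h ∧ f = homD p h := by
  obtain ⟨n₀, hM⟩ := hM
  obtain ⟨s, hs, hds⟩ := A.exists_contraction hA
  refine exists_homD_eq p M.cobarFilt ?_ (fun n => ?_) (fun j f hf hfd hfF => ?_) f hf hfd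
  · exact eq_top_iff.2 fun x _ => M.mem_cobarFilt.2 fun n hn => absurd hn n.not_lt_zero
  · exact ⟨(n - n₀ + 1).toNat, fun j hj x hx hxn =>
      M.eq_zero_of_mem_cobarFilt hC hM (p := n) (j := j) (by omega) hx hxn⟩
  · obtain ⟨u, hu, hfu⟩ := exists_cofreeLift_sub_mem hs hds p j hf.map_mem hf.colinear hfd hfF
    refine ⟨M.incl j ∘ₗ cofreeLift j (j + p + 1) u, ⟨fun n x hx => ?_, ?_⟩,
      fun x => M.incl_mem_cobarFilt j _, hfu⟩
    · exact lof_mem_totalDeg M.summand (by omega) (cofreeLift_mem j (j + p + 1) hu hx)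
    -- The lift was given the exponent `j + p + 1` so that the extra `j` from the shift of the
    -- summand cancels modulo `2`.
    · have h1 : C.parity ^ (j + (j + p + 1)) = C.parity ^ (p + 1) := by
        rw [add_assoc j p 1, ← add_assoc, pow_add, pow_add, C.parity_pow_mul_self, one_mul]
      exact (cofreeLift_colinear j (j + p + 1) u).trans (by rw [h1]; rfl)

end DGComodule

/-! ### Mapping cones of DG comodules. -/

section Cone

variable {A B : DGComodule.{u, v} C} (s : A ⟶ B)

/-- The complex underlying the mapping cone of `s : A → B`: in degree `n` it is
`B_n × A_{n + 1}`, with differential `(b, a) ↦ (d b + s a, -d a)`. -/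
abbrev coneComplex : DGModule.{u, v} k where
  carrier := B.carrier × A.carrier
  deg n := (B.deg n).prod (A.deg (n + 1))
  isInternal := by
    let Φ : B.carrier × A.carrier →ₗ[k] (ℤ →₀ B.carrier × A.carrier) :=
      (Finsupp.mapRange.linearMap (LinearMap.inl k _ _) ∘ₗ B.comps).coprod
        (Finsupp.mapRange.linearMap (LinearMap.inr k _ _) ∘ₗ
          Finsupp.lmapDomain A.carrier k (fun n : ℤ => n - 1) ∘ₗ A.comps)
    refine isInternal_of_split _ (eq_top_iff.2 ?_) Φ ?_
    · rintro ⟨b, a⟩ -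
      have hb : (⊤ : Submodule k B.carrier) ≤
          (⨆ n, (B.deg n).prod (A.deg (n + 1))).comap (LinearMap.inl k _ _) := by
        rw [← B.isInternal.submodule_iSup_eq_top]
        exact iSup_le fun n x hx => Submodule.mem_iSup_of_mem n ⟨hx, Submodule.zero_mem _⟩
      have ha : (⊤ : Submodule k A.carrier) ≤
          (⨆ n, (B.deg n).prod (A.deg (n + 1))).comap (LinearMap.inr k _ _) := by
        rw [← A.isInternal.submodule_iSup_eq_top]
        refine iSup_le fun n x hx => Submodule.mem_iSup_of_mem (n - 1) ⟨Submodule.zero_mem _, ?_⟩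
        simpa using hx
      have hb' := hb (Submodule.mem_top : b ∈ _)
      have ha' := ha (Submodule.mem_top : a ∈ _)
      rw [Submodule.mem_comap] at hb' ha'
      simpa using Submodule.add_mem _ hb' ha'
    · rintro n ⟨b, a⟩ ⟨hb, ha⟩
      have hb : b ∈ B.deg n := hb
      have ha : a ∈ A.deg (n + 1) := ha
      simp [Φ, B.comps_of_mem hb, A.comps_of_mem ha, Finsupp.mapDomain_single,
        ← Finsupp.single_add]
  d := (LinearMap.inl k _ _ ∘ₗ B.d).coprod
    (LinearMap.inl k _ _ ∘ₗ s.lin - LinearMap.inr k _ _ ∘ₗ A.d)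
  d_mem := by
    rintro n ⟨b, a⟩ ⟨hb, ha⟩
    have h1 : B.d b + s.lin a ∈ B.deg (n + 1) :=
      Submodule.add_mem _ (B.d_mem hb) (s.map_mem ha)
    have h2 : -A.d a ∈ A.deg (n + 1 + 1) := Submodule.neg_mem _ (A.d_mem ha)
    exact ⟨by simpa using h1, by simpa using h2⟩
  d_comp_d := by
    refine LinearMap.ext fun ⟨b, a⟩ => ?_
    have h1 : B.d (B.d b) = 0 := LinearMap.congr_fun B.d_comp_d b
    have h2 : A.d (A.d a) = 0 := LinearMap.congr_fun A.d_comp_d a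
    have h3 : s.lin (A.d a) = B.d (s.lin a) := LinearMap.congr_fun s.comp_d a
    simp [h1, h2, h3]

theorem coneComplex_d (b : B.carrier) (a : A.carrier) :
    (coneComplex s).d (b, a) = (B.d b + s.lin a, -A.d a) := by
  simp

/-- The coaction `(b, a) ↦ ∑ c ⊗ (b', 0) + ∑ (-1)^|c| c ⊗ (0, a')` of the mapping cone. -/
def coneCoact (A B : DGComodule.{u, v} C) :
    B.carrier × A.carrier →ₗ[k] C.carrier ⊗[k] (B.carrier × A.carrier) :=
  (TensorProduct.map LinearMap.id (LinearMap.inl k _ _) ∘ₗ B.coact).coprod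
    (TensorProduct.map C.parity (LinearMap.inr k _ _) ∘ₗ A.coact)

theorem coneCoact_apply (b : B.carrier) (a : A.carrier) :
    coneCoact A B (b, a) = TensorProduct.map LinearMap.id (LinearMap.inl k _ _) (B.coact b) +
      TensorProduct.map C.parity (LinearMap.inr k _ _) (A.coact a) := by
  simp [coneCoact]

theorem map_comp_coneCoact {X : Type v} [AddCommGroup X] [Module k X]
    (σ : C.carrier →ₗ[k] C.carrier) (F : B.carrier × A.carrier →ₗ[k] X) (b : B.carrier)
    (a : A.carrier) :
    TensorProduct.map σ F (coneCoact A B (b, a)) =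
      TensorProduct.map σ (F ∘ₗ LinearMap.inl k _ _) (B.coact b) +
        TensorProduct.map (σ ∘ₗ C.parity) (F ∘ₗ LinearMap.inr k _ _) (A.coact a) := by
  rw [coneCoact_apply, map_add, TensorProduct.map_map, TensorProduct.map_map, LinearMap.comp_id]

/-- The mapping cone of a morphism of differential graded comodules. -/
abbrev cone : DGComodule.{u, v} C where
  toDGModule := coneComplex s
  coact := coneCoact A B
  coact_mem := by
    rintro n ⟨b, a⟩ ⟨hb, ha⟩
    rw [coneCoact_apply]
    refine Submodule.add_mem _ ?_ ?_
    · exact map_mem_tensorDeg (a := 0) (b := 0) (W' := coneComplex s) (fun m x hx => by simpa using hx)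
        (fun m x hx => by simpa using hx) (by omega) (B.coact_mem hb)
    · exact map_mem_tensorDeg (a := 0) (b := -1) (W' := coneComplex s)
        (fun m x hx => by simpa using C.parity_mem hx) (fun m x hx => by simpa using hx) (by omega)
        (A.coact_mem ha)
  coact_comp_d := by
    refine LinearMap.ext fun ⟨b, a⟩ => ?_
    have h1 : B.coact (B.d b) = tensorD C.toDGModule B.toDGModule (B.coact b) :=
      LinearMap.congr_fun B.coact_comp_d b
    have h2 : A.coact (A.d a) = tensorD C.toDGModule A.toDGModule (A.coact a) :=
      LinearMap.congr_fun A.coact_comp_d a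
    have h3 : B.coact (s.lin a) = TensorProduct.map LinearMap.id s.lin (A.coact a) :=
      LinearMap.congr_fun s.colinear a
    have e1 : ∀ t, TensorProduct.map LinearMap.id (LinearMap.inl k B.carrier A.carrier)
        (tensorD C.toDGModule B.toDGModule t) = tensorD C.toDGModule (coneComplex s)
          (TensorProduct.map LinearMap.id (LinearMap.inl k _ _) t) := by
      intro t
      induction t with
      | zero => simp
      | add x y hx hy => simp only [map_add, hx, hy]
      | tmul c x => simp [tensorD]
    -- The twist by `C.parity` on the `A` part produces the minus sign of `-d` when `C` is
    -- differentiated, and it cancels the Koszul sign in front of `s`.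
    have e2 : ∀ t, TensorProduct.map LinearMap.id (LinearMap.inl k B.carrier A.carrier)
          (TensorProduct.map LinearMap.id s.lin t) -
        TensorProduct.map C.parity (LinearMap.inr k _ _)
          (tensorD C.toDGModule A.toDGModule t) = tensorD C.toDGModule (coneComplex s)
          (TensorProduct.map C.parity (LinearMap.inr k _ _) t) := by
      intro t
      induction t with
      | zero => simp
      | add x y hx hy =>
        simp only [map_add] at hx hy ⊢
        rw [← hx, ← hy]
        abel
      | tmul c x =>
        have h4 : C.parity (C.d c) = -C.d (C.parity c) := LinearMap.congr_fun C.parity_comp_d c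
        have h5 : C.parity (C.parity c) = c := LinearMap.congr_fun C.parity_comp_parity c
        have h6 : (coneComplex s).d (0, x) = (s.lin x, 0) - (0, A.d x) := by
          simp
        simp only [tensorD, LinearMap.add_apply, TensorProduct.map_tmul, LinearMap.id_apply,
          LinearMap.inl_apply, LinearMap.inr_apply, map_add, h4, h5, h6, TensorProduct.neg_tmul,
          TensorProduct.tmul_sub]
        abel
    change coneCoact A B ((coneComplex s).d (b, a)) =
      tensorD C.toDGModule (coneComplex s) (coneCoact A B (b, a))
    rw [coneComplex_d, coneCoact_apply, coneCoact_apply, map_add B.coact, map_neg A.coact, h1, h2,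
      h3, map_add, map_neg, map_add (tensorD _ _), ← e1, ← e2]
    abel
  coassoc := by
    refine LinearMap.ext fun ⟨b, a⟩ => ?_
    have h1 : C.comulTensor B.carrier (B.coact b) =
        TensorProduct.map LinearMap.id B.coact (B.coact b) := LinearMap.congr_fun B.coassoc b
    have h2 : C.comulTensor A.carrier (A.coact a) =
        TensorProduct.map LinearMap.id A.coact (A.coact a) := LinearMap.congr_fun A.coassoc a
    have e1 := LinearMap.congr_fun
      (C.comulTensor_naturality (LinearMap.inl k B.carrier A.carrier)) (B.coact b)
    have e2 := C.comulTensor_map_parity_pow 1 (LinearMap.inr k B.carrier A.carrier) (A.coact a)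
    have f1 : coneCoact A B ∘ₗ LinearMap.inl k _ _ =
        TensorProduct.map LinearMap.id (LinearMap.inl k _ _) ∘ₗ B.coact := LinearMap.coprod_inl _ _
    have f2 : coneCoact A B ∘ₗ LinearMap.inr k _ _ =
        TensorProduct.map C.parity (LinearMap.inr k _ _) ∘ₗ A.coact := LinearMap.coprod_inr _ _
    rw [pow_one] at e2
    change C.comulTensor _ (coneCoact A B (b, a)) =
      TensorProduct.map LinearMap.id (coneCoact A B) (coneCoact A B (b, a))
    rw [map_comp_coneCoact, f1, f2, coneCoact_apply, map_add, e2, h2]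
    refine congrArg₂ (· + ·) (e1.trans ?_) ?_
    · rw [LinearMap.comp_apply, h1, TensorProduct.map_map, LinearMap.id_comp]
    · rw [TensorProduct.map_map, LinearMap.comp_id, LinearMap.id_comp]
  counit_coact := by
    refine LinearMap.ext fun ⟨b, a⟩ => ?_
    have h1 : C.counitTensor B.carrier (B.coact b) = b := LinearMap.congr_fun B.counit_coact b
    have h2 : C.counitTensor A.carrier (A.coact a) = a := LinearMap.congr_fun A.counit_coact a
    have e1 := C.counitTensor_naturality (LinearMap.inl k B.carrier A.carrier) (B.coact b)
    have e2 : ∀ t, C.counitTensor _ (TensorProduct.map C.parity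
        (LinearMap.inr k B.carrier A.carrier) t) = LinearMap.inr k _ _ (C.counitTensor _ t) := by
      intro t
      induction t with
      | zero => simp only [map_zero]
      | add x y hx hy => simp only [map_add, hx, hy]
      | tmul c x =>
        have h2 : Coalgebra.counit (R := k) (C.parity c) = Coalgebra.counit (R := k) c :=
          LinearMap.congr_fun C.counit_comp_parity c
        simp [DGCoalgebra.counitTensor_tmul, h2]
    change C.counitTensor _ (coneCoact A B (b, a)) = (b, a)
    rw [coneCoact_apply, map_add, e1, e2, h1, h2]
    simp

/-- For a cycle `(b, a)`, the class of `a` dies under `s`, so injectivity in homology gives `a = d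
a₁`. Surjectivity then writes the cycle `b + s a₁` as `s z` plus a boundary `d b₁`, and `(b₁, z -
a₁)` is a primitive. -/
theorem ker_cone_d_le (hs : QuasiIso s) :
    LinearMap.ker (cone s).d ≤ LinearMap.range (cone s).d := by
  rintro ⟨b, a⟩ h
  have h : (B.d b + s.lin a, -A.d a) = (0 : B.carrier × A.carrier) :=
    (coneComplex_d s b a).symm.trans h
  have hb : B.d b + s.lin a = 0 := congrArg Prod.fst h
  have ha : A.d a = 0 := neg_eq_zero.1 (congrArg Prod.snd h)
  have hsd : ∀ x, s.lin (A.d x) = B.d (s.lin x) := LinearMap.congr_fun s.comp_d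
  obtain ⟨a₁, ha₁⟩ : ∃ a₁, A.d a₁ = a := by
    have h1 : homologyMap s (Submodule.Quotient.mk ⟨a, ha⟩) = homologyMap s 0 := by
      rw [map_zero]
      refine (Submodule.Quotient.mk_eq_zero _).2 ⟨-b, ?_⟩
      rw [map_neg, neg_eq_of_add_eq_zero_right hb]
      rfl
    exact (Submodule.Quotient.mk_eq_zero _).1 (hs.1 h1)
  have hz : b + s.lin a₁ ∈ LinearMap.ker B.d := by
    rw [LinearMap.mem_ker, map_add, ← hsd, ha₁, hb]
  obtain ⟨z, hz'⟩ := hs.2 (Submodule.Quotient.mk ⟨_, hz⟩)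
  obtain ⟨⟨z, hzd⟩, rfl⟩ := Submodule.Quotient.mk_surjective _ z
  obtain ⟨b₁, hb₁⟩ := (Submodule.Quotient.eq _).1 hz'.symm
  have hb₁ : B.d b₁ = b + s.lin a₁ - s.lin z := hb₁
  have hzd : A.d z = 0 := hzd
  refine ⟨(b₁, z - a₁), (coneComplex_d s b₁ (z - a₁)).trans ?_⟩
  rw [hb₁, map_sub, map_sub, hzd, ha₁]
  ext <;> simp

end Cone

/-! ### Extending morphisms and homotopies along quasi-isomorphisms. -/

section Local

variable {M A B : DGComodule.{u, v} C}

/-- A homotopy `h` from `s ≫ g` to `s ≫ g'` is exactly what makes `(g - g', h)` a closed map of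
degree `0` on the cone of `s`. The cone is acyclic, so this map is a boundary `homD 0 H`, and the
restriction of `H` to `B` is a homotopy from `g` to `g'`. -/
theorem homotopic_of_comp_homotopic (hC : C.PositivelyGraded) (hM : M.LeftBounded) {s : A ⟶ B}
    (hs : QuasiIso s) {g g' : B ⟶ M.cobar} (h : Homotopic C (s ≫ g) (s ≫ g')) :
    Homotopic C g g' := by
  obtain ⟨h, hdeg, hco, hh⟩ := h
  let F : (cone s).carrier →ₗ[k] M.cobar.carrier := (g.lin - g'.lin).coprod h
  have hsub : M.cobar.coact ∘ₗ (g.lin - g'.lin) =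
      TensorProduct.map LinearMap.id (g.lin - g'.lin) ∘ₗ B.coact := by
    rw [DGPrecomodule.map_id_sub, LinearMap.comp_sub, LinearMap.sub_comp, g.colinear, g'.colinear]
  have hF : IsGradedColinear ((0 : ℕ) : ℤ) 0 F := by
    refine ⟨?_, LinearMap.ext fun ⟨b, a⟩ => ?_⟩
    · rintro n ⟨b, a⟩ ⟨hb, ha⟩
      have h1 := hdeg _ _ ha
      rw [add_sub_cancel_right] at h1
      simpa [F] using Submodule.add_mem _ (Submodule.sub_mem _ (g.map_mem hb) (g'.map_mem hb)) h1
    · have e := map_comp_coneCoact (A := A) (B := B) LinearMap.id F b a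
      have e1 : F ∘ₗ LinearMap.inl k _ _ = g.lin - g'.lin := LinearMap.coprod_inl _ _
      have e2 : F ∘ₗ LinearMap.inr k _ _ = h := LinearMap.coprod_inr _ _
      rw [e1, e2, LinearMap.id_comp] at e
      rw [pow_zero, Module.End.one_eq_id]
      refine Eq.trans ?_ e.symm
      change M.cobar.coact (F (b, a)) = _
      rw [LinearMap.coprod_apply, map_add]
      exact congrArg₂ (· + ·) (LinearMap.congr_fun hsub b) (LinearMap.congr_fun hco a)
  have hFd : F ∘ₗ (cone s).d = (-1 : k) ^ 0 • (M.cobar.d ∘ₗ F) := by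
    refine LinearMap.ext fun ⟨b, a⟩ => ?_
    have h1 : g.lin (s.lin a) - g'.lin (s.lin a) = h (A.d a) + M.cobar.d (h a) :=
      LinearMap.congr_fun hh a
    have h2 : g.lin (B.d b) = M.cobar.d (g.lin b) := LinearMap.congr_fun g.comp_d b
    have h3 : g'.lin (B.d b) = M.cobar.d (g'.lin b) := LinearMap.congr_fun g'.comp_d b
    rw [pow_zero, one_smul]
    change F ((coneComplex s).d (b, a)) = M.cobar.d (F (b, a))
    rw [coneComplex_d, LinearMap.coprod_apply, LinearMap.coprod_apply, map_add, map_neg, map_add,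
      LinearMap.sub_apply, LinearMap.sub_apply, LinearMap.sub_apply, h1, h2, h3, map_sub]
    abel
  obtain ⟨H, hH, hFH⟩ := M.exists_homD_eq_of_acyclic hC hM (ker_cone_d_le s hs) 0 F hF hFd
  refine ⟨H ∘ₗ LinearMap.inl k _ _, fun n x hx => ?_, LinearMap.ext fun x => ?_,
    LinearMap.ext fun x => ?_⟩
  · have := hH.map_mem n (x, 0) ⟨hx, Submodule.zero_mem _⟩
    simpa [sub_eq_add_neg] using this
  · have e := map_comp_coneCoact (A := A) (B := B) (C.parity ^ 1) H x 0
    rw [map_zero, map_zero, add_zero] at e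
    rw [zero_add] at hH
    have := (LinearMap.congr_fun hH.colinear ((x, 0) : B.carrier × A.carrier)).trans e
    rwa [pow_one] at this
  · have h1 : F (x, 0) = homD 0 H ((x, 0) : B.carrier × A.carrier) := LinearMap.congr_fun hFH (x, 0)
    have h2 : homD 0 H ((x, 0) : B.carrier × A.carrier) =
      M.cobar.d (H (x, 0)) + (-1 : k) ^ 0 • H ((coneComplex s).d (x, 0)) := rfl
    rw [h2, coneComplex_d, LinearMap.coprod_apply, map_zero, add_zero, pow_zero, one_smul, map_zero,
      map_zero, neg_zero, add_zero, add_comm] at h1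
    exact h1

/-- The map `(b, a) ↦ f a` is closed of degree `1` on the acyclic cone, hence equals `d H - H d`
with `H` of degree `0`. Restricted to `B` this says that `H` is a morphism there; restricted to `A`
it says that the `A` part of `H` is a homotopy from `f` to `s` followed by minus the `B` part,
whence the sign in `g`. -/
theorem exists_comp_homotopic (hC : C.PositivelyGraded) (hM : M.LeftBounded) {s : A ⟶ B}
    (hs : QuasiIso s) (f : A ⟶ M.cobar) : ∃ g : B ⟶ M.cobar, Homotopic C f (s ≫ g) := by
  let F : (cone s).carrier →ₗ[k] M.cobar.carrier := f.lin ∘ₗ LinearMap.snd k B.carrier A.carrier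
  have hF : IsGradedColinear ((1 : ℕ) : ℤ) 1 F := by
    refine ⟨?_, LinearMap.ext fun ⟨b, a⟩ => ?_⟩
    · rintro n ⟨b, a⟩ ⟨hb, ha⟩
      exact f.map_mem ha
    · have e := map_comp_coneCoact (A := A) (B := B) (C.parity ^ 1) F b a
      have e1 : F ∘ₗ LinearMap.inl k _ _ = 0 := by ext; simp [F]
      have e2 : F ∘ₗ LinearMap.inr k _ _ = f.lin := by ext; simp [F]
      rw [e1, e2, TensorProduct.map_zero_right, LinearMap.zero_apply, zero_add, pow_one,
        C.parity_comp_parity] at e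
      refine Eq.trans ?_ ((pow_one C.parity).symm ▸ e.symm)
      exact LinearMap.congr_fun f.colinear a
  have hFd : F ∘ₗ (cone s).d = (-1 : k) ^ 1 • (M.cobar.d ∘ₗ F) := by
    refine LinearMap.ext fun ⟨b, a⟩ => ?_
    have h1 : f.lin (A.d a) = M.cobar.d (f.lin a) := LinearMap.congr_fun f.comp_d a
    change F ((coneComplex s).d (b, a)) = (-1 : k) ^ 1 • M.cobar.d (F (b, a))
    rw [coneComplex_d, pow_one, neg_one_smul]
    change f.lin (-A.d a) = -M.cobar.d (f.lin a)
    rw [map_neg, h1]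
  obtain ⟨H, hH, hFH⟩ := M.exists_homD_eq_of_acyclic hC hM (ker_cone_d_le s hs) 1 F hF hFd
  -- `H` has degree `0`, recorded with sign exponent `2`, so it is colinear without sign.
  have hH2 : (C.parity ^ (1 + 1) : Module.End k C.carrier) = LinearMap.id :=
    (pow_add C.parity 1 1).trans (C.parity_pow_mul_self 1)
  have key : ∀ b a, f.lin a = M.cobar.d (H (b, a)) - H (B.d b + s.lin a, -A.d a) := fun b a => by
    have h1 : F (b, a) = homD 1 H ((b, a) : B.carrier × A.carrier) := LinearMap.congr_fun hFH (b, a)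
    have h2 : homD 1 H ((b, a) : B.carrier × A.carrier) =
      M.cobar.d (H (b, a)) + (-1 : k) ^ 1 • H ((coneComplex s).d (b, a)) := rfl
    rw [h2, coneComplex_d, pow_one, neg_one_smul, ← sub_eq_add_neg] at h1
    exact h1
  have hcol : ∀ b a, M.cobar.coact (H (b, a)) =
      TensorProduct.map LinearMap.id (H ∘ₗ LinearMap.inl k _ _) (B.coact b) +
        TensorProduct.map C.parity (H ∘ₗ LinearMap.inr k _ _) (A.coact a) := fun b a => by
    have e := map_comp_coneCoact (A := A) (B := B) LinearMap.id H b a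
    have h1 := LinearMap.congr_fun hH.colinear ((b, a) : B.carrier × A.carrier)
    rw [hH2] at h1
    exact h1.trans e
  let g : B ⟶ M.cobar :=
    { lin := -(H ∘ₗ LinearMap.inl k B.carrier A.carrier)
      map_mem := fun {n x} hx => by
        have := hH.map_mem n (x, 0) ⟨hx, Submodule.zero_mem _⟩
        simpa using Submodule.neg_mem _ this
      comp_d := LinearMap.ext fun x => by
        have h1 := key x 0
        simp only [map_zero, neg_zero, add_zero] at h1
        change -H (B.d x, 0) = M.cobar.d (-H (x, 0))
        rw [map_neg, sub_eq_zero.1 h1.symm]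
      colinear := LinearMap.ext fun x => by
        have h1 := hcol x 0
        rw [map_zero, map_zero, add_zero] at h1
        rw [← neg_one_smul k (H ∘ₗ LinearMap.inl k _ _), TensorProduct.map_smul_right,
          LinearMap.comp_smul, LinearMap.smul_comp]
        exact congrArg ((-1 : k) • ·) h1 }
  refine ⟨g, H ∘ₗ LinearMap.inr k _ _, fun n x hx => ?_, LinearMap.ext fun x => ?_,
    LinearMap.ext fun x => ?_⟩
  · have := hH.map_mem (n - 1) ((0, x) : B.carrier × A.carrier)
      ⟨Submodule.zero_mem _, (sub_add_cancel n 1).symm ▸ hx⟩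
    simpa using this
  · have h1 := hcol 0 x
    rw [map_zero, map_zero, zero_add] at h1
    exact h1
  · have h1 := key 0 x
    have h2 : H (s.lin x, -A.d x) = H (s.lin x, 0) - H (0, A.d x) := by
      rw [← map_sub]; congr 1; ext <;> simp
    rw [map_zero, zero_add, h2] at h1
    change f.lin x - (-H (s.lin x, 0)) = H (0, A.d x) + M.cobar.d (H (0, x))
    rw [h1]
    abel

/-- The two preceding results are injectivity and surjectivity of precomposition with a
quasi-isomorphism on homotopy classes, so `M.cobar` is local and the localization criterion applies.
-/
theorem isClosedObj_cobar (hC : C.PositivelyGraded) (hM : M.LeftBounded) :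
    IsClosedObj M.cobar := by
  refine fun N => bijective_Q_map_of_isLocal (quasiIsos C) ((toH C).obj M.cobar) ?_ ((toH C).obj N)
  rintro A B _ ⟨s, rfl, hs⟩
  constructor
  · intro φ ψ h
    obtain ⟨g, rfl⟩ := (toH C).map_surjective φ
    obtain ⟨g', rfl⟩ := (toH C).map_surjective ψ
    have h : (toH C).map (s ≫ g) = (toH C).map (s ≫ g') := by
      simpa only [Functor.map_comp] using h
    exact CategoryTheory.Quotient.sound _ (homotopic_of_comp_homotopic hC hM hs
      ((CategoryTheory.Quotient.functor_map_eq_iff _ _ _).1 h))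
  · intro φ
    obtain ⟨f, rfl⟩ := (toH C).map_surjective φ
    obtain ⟨g, hg⟩ := exists_comp_homotopic hC hM hs f
    refine ⟨(toH C).map g, ?_⟩
    have := CategoryTheory.Quotient.sound (Homotopic C) hg
    exact (this.trans ((toH C).map_comp s g)).symm

end Local

/-! ### The unit `M → C(M)` is a quasi-isomorphism. -/

namespace DGComodule

variable (M : DGComodule.{u, v} C)

/-- The map `(c_1, …, c_{n + 2}, m) ↦ ε(c_1) (c_2, …, c_{n + 2}, m)`. -/
def counitStep (n : ℕ) : M.summand (n + 1) →ₗ[k] M.summand n :=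
  C.counitTensor (M.power (n + 1)).carrier

theorem counitStep_d (n : ℕ) (x : M.summand (n + 1)) :
    M.counitStep n ((M.summand (n + 1)).d x) = (M.summand n).d (M.counitStep n x) :=
  C.counitTensor_tensorD (M.power (n + 1)).toDGModule x

/-- The left counit law disposes of the term `Δ ⊗ id`, and naturality moves the counit past the
structure map. Applied to the powers of `M`, this is the contraction identity for `b'`. -/
theorem counitTensor_bar (W : DGPrecomodule.{u, v} C) (x : C.carrier ⊗[k] W.carrier) :
    C.counitTensor _ (W.bar x) = x - W.coact (C.counitTensor W.carrier x) := by
  rw [DGPrecomodule.bar, LinearMap.sub_apply, map_sub, C.counitTensor_comulTensor,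
    C.counitTensor_naturality]

theorem counitStep_bPrime_zero (x : M.summand 0) :
    M.counitStep 0 (M.bPrime 0 x) = x - M.coactZero (C.counitTensor M.carrier x) :=
  counitTensor_bar (M.power 0) x

theorem counitStep_bPrime_succ (n : ℕ) (x : M.summand (n + 1)) :
    M.counitStep (n + 1) (M.bPrime (n + 1) x) = x - M.bPrime n (M.counitStep n x) :=
  counitTensor_bar (M.power (n + 1)) x

/-- The contraction of the standard resolution that is `ε ⊗ id` on each summand but the first. -/
def cobarContraction : (⨁ n, M.summand n) →ₗ[k] ⨁ n, M.summand n :=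
  DirectSum.toModule k ℕ _ fun n =>
    match n with
    | 0 => 0
    | n + 1 => M.incl n ∘ₗ M.counitStep n

/-- The retraction `ε ⊗ id : C ⊗ M → M` of the standard resolution to `M`. -/
def cobarRetraction : (⨁ n, M.summand n) →ₗ[k] M.carrier :=
  C.counitTensor M.carrier ∘ₗ M.proj 0

theorem cobarContraction_incl_zero (x : M.summand 0) : M.cobarContraction (M.incl 0 x) = 0 := by
  rw [cobarContraction, DirectSum.toModule_lof]; rfl

theorem cobarContraction_incl_succ (n : ℕ) (x : M.summand (n + 1)) :
    M.cobarContraction (M.incl (n + 1) x) = M.incl n (M.counitStep n x) := by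
  rw [cobarContraction, DirectSum.toModule_lof]; rfl

/-- The internal differentials cancel because their signs alternate with the tensor length, while
`counitTensor_bar` makes the `b'` terms add up to the identity. Only the first summand leaves a
defect, the projection onto the image of `M`. The contraction is merely `k`-linear, which suffices
for homology. -/
theorem d_cobarContraction (x : ⨁ n, M.summand n) :
    M.cobarComplex.d (M.cobarContraction x) + M.cobarContraction (M.cobarComplex.d x) =
      x - M.incl 0 (M.coactZero (M.cobarRetraction x)) := by
  have : M.cobarComplex.d ∘ₗ M.cobarContraction + M.cobarContraction ∘ₗ M.cobarComplex.d =
      LinearMap.id - M.incl 0 ∘ₗ M.coactZero ∘ₗ M.cobarRetraction := by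
    refine DirectSum.linearMap_ext _ fun n => LinearMap.ext fun x => ?_
    change M.cobarComplex.d (M.cobarContraction (M.incl n x)) +
      M.cobarContraction (M.cobarComplex.d (M.incl n x)) =
        M.incl n x - M.incl 0 (M.coactZero (M.cobarRetraction (M.incl n x)))
    rw [cobarComplex_d_incl, map_add, map_smul, cobarContraction_incl_succ]
    cases n with
    | zero =>
      have h : M.cobarRetraction (M.incl 0 x) = C.counitTensor M.carrier x :=
        congrArg (C.counitTensor M.carrier) (M.proj_incl_self 0 x)
      rw [cobarContraction_incl_zero, cobarContraction_incl_zero, map_zero, smul_zero, zero_add,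
        zero_add, counitStep_bPrime_zero, h, map_sub]
    | succ n =>
      have h : M.cobarRetraction (M.incl (n + 1) x) = 0 :=
        (congrArg (C.counitTensor M.carrier) (M.proj_incl_of_ne n.succ_ne_zero x)).trans
          (map_zero (C.counitTensor M.carrier))
      have e : ∀ y : ⨁ n, M.summand n, (-1 : k) ^ (n + 1) • y = -((-1 : k) ^ n • y) := fun y => by
        rw [pow_succ, mul_neg_one]; exact neg_smul _ y
      rw [cobarContraction_incl_succ, cobarContraction_incl_succ, h, map_zero, map_zero, sub_zero,
        cobarComplex_d_incl, counitStep_d, counitStep_bPrime_succ, map_sub, e]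
      abel
  exact LinearMap.congr_fun this x

theorem cobarRetraction_d (x : ⨁ n, M.summand n) :
    M.cobarRetraction (M.cobarComplex.d x) = M.d (M.cobarRetraction x) := by
  change C.counitTensor M.carrier (M.proj 0 (M.cobarComplex.d x)) = _
  rw [proj_zero_d]
  exact C.counitTensor_tensorD M.toDGModule _

theorem cobarRetraction_coact (x : M.carrier) :
    M.cobarRetraction (M.incl 0 (M.coactZero x)) = x :=
  (congrArg (C.counitTensor M.carrier) (M.proj_incl_self 0 _)).trans
    (LinearMap.congr_fun M.counit_coact x)

theorem quasiIso_cobarUnit : QuasiIso M.cobarUnit := by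
  constructor
  · rw [← LinearMap.ker_eq_bot, eq_bot_iff]
    intro z hz
    obtain ⟨⟨x, hx⟩, rfl⟩ := Submodule.Quotient.mk_surjective _ z
    obtain ⟨y, hy⟩ : ∃ y : ⨁ n, M.summand n, M.cobarComplex.d y = M.incl 0 (M.coactZero x) :=
      (Submodule.Quotient.mk_eq_zero _).1 (LinearMap.mem_ker.1 hz)
    -- The retraction is a chain map left inverse to the unit, so it carries a primitive of `ρ x` to
    -- a primitive of `x`.
    refine (Submodule.Quotient.mk_eq_zero _).2 ⟨M.cobarRetraction y, ?_⟩
    rw [← cobarRetraction_d, hy, cobarRetraction_coact]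
    rfl
  · intro z
    obtain ⟨y, hy, rfl⟩ : ∃ (y : ⨁ n, M.summand n) (hy : M.cobarComplex.d y = 0),
        (Submodule.Quotient.mk ⟨y, hy⟩ : M.cobar.Homology) = z := by
      obtain ⟨⟨y, hy⟩, rfl⟩ := Submodule.Quotient.mk_surjective _ z
      exact ⟨y, hy, rfl⟩
    have h1 : M.d (M.cobarRetraction y) = 0 := by rw [← cobarRetraction_d, hy, map_zero]
    refine ⟨Submodule.Quotient.mk ⟨M.cobarRetraction y, h1⟩, ?_⟩
    -- For a cycle `y` the contraction identity exhibits `y` minus the image of its retraction as a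
    -- boundary.
    refine (Submodule.Quotient.eq _).2 ⟨-M.cobarContraction y, ?_⟩
    have h2 := M.d_cobarContraction y
    rw [hy, map_zero, add_zero] at h2
    change M.cobarComplex.d (-M.cobarContraction y) =
      M.incl 0 (M.coactZero (M.cobarRetraction y)) - y
    rw [map_neg, h2, neg_sub]

end DGComodule

/-- Faithfulness and fullness are closedness of the target object. For essential surjectivity, an
object of `D⁺(C)` is isomorphic to a left bounded `N`, and the unit `N → C(N)` becomes invertible in
`D(C)` with `C(N)` closed and left bounded. -/
theorem isEquivalence_closedToDPlus (C : DGCoalgebra.{u, v} k) (hC : C.PositivelyGraded) :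
    (closedToDPlus C).IsEquivalence where
  faithful := ⟨fun {X Y} f g h => by
    have h : (toD C).map f.hom = (toD C).map g.hom := congrArg (fun t => t.hom) h
    exact ObjectProperty.hom_ext _ ((Y.2.2 X.1.as).1 h)⟩
  full := ⟨fun {X Y} φ => by
    obtain ⟨f, hf⟩ := (Y.2.2 X.1.as).2 φ.hom
    exact ⟨ObjectProperty.homMk f, ObjectProperty.hom_ext _ hf⟩⟩
  essSurj := ⟨by
    rintro ⟨Y, N, hN, ⟨e⟩⟩
    have hq : quasiIsos C ((toH C).map N.cobarUnit) := ⟨N.cobarUnit, rfl, N.quasiIso_cobarUnit⟩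
    refine ⟨⟨(toH C).obj N.cobar, ⟨N.cobar, N.cobar_leftBounded hC hN, ⟨Iso.refl _⟩⟩,
      isClosedObj_cobar hC hN⟩, ⟨(dPlus C).isoMk ?_⟩⟩
    exact (Localization.isoOfHom (toD C) (quasiIsos C) _ hq).symm ≪≫ e.symm⟩

end DGCo

end

theorem mainTheorem6 {k : Type u} [Field k] (C : DGCo.DGCoalgebra.{u, v} k)
    (hC : C.PositivelyGraded) :
    (∀ M : DGCo.DGComodule.{u, v} C, M.LeftBounded →
      DGCo.IsClosedObj ((DGCo.cobarFunctor C).obj M) ∧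
      ((DGCo.cobarFunctor C).obj M).LeftBounded ∧
      DGCo.QuasiIso ((DGCo.cobarNat C).app M)) ∧
    (DGCo.closedToDPlus C).IsEquivalence :=
  ⟨fun M hM => ⟨DGCo.isClosedObj_cobar hC hM, M.cobar_leftBounded hC hM, M.quasiIso_cobarUnit⟩,
    DGCo.isEquivalence_closedToDPlus C hC⟩
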